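/- Let $q:\mathbb R\to\mathbb R$ be integrable with compact (essential) support, and consider $-f''+qf=k^2f$, $k\in\mathbb C$. For every $k$ there are unique solutions $\psi_\pm(\cdot,k)$ on $\mathbb R$ with $\psi_+(x,k)=e^{ikx}$ for all large positive $x$ and $\psi_-(x,k)=e^{-ikx}$ for all large negative $x$. Put $\|q\|=\int_{\mathbb R}|q(t)|\,dt$ and $\|q\|_1=\int_{\mathbb R}|t\,q(t)|\,dt$. Consider three cases. Case 1 (the operator $-d^2/dx^2+q$ on $\mathbb R$): $\operatorname{supp}q\subset[0,\gamma]$, $\gamma\ge0$, and $\operatorname{supp} q$ lies in no shorter compact interval; $F(k)=w(k)=\psi_-\psi_+'-\psi_-'\psi_+$ is the Wronskian; $\mathcal Q=\max\{\|q\|,\|q\|_1\}$. Cases 2 and 3 (the operator $-d^2/dx^2+q$ on $\mathbb R_+$ with boundary condition $f(0)=0$, respectively $f'(0)=0$): $\operatorname{supp}q\subset[0,\infty)$ ($q$ is extended by zero to the negative axis) and $\gamma=\sup\operatorname{supp}q$ ($\gamma=0$ if $q=0$); $F(k)=\psi_+(0,k)$ in Case 2 and $F(k)=\psi_+'(0,k)$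 in Case 3; $\mathcal Q=2\|q\|\max\{1,\gamma\}$. Then $F$ is entire. Let $(k_n)$ be its zeros, repeated according to multiplicity (these are the square roots in the open upper half-plane of the negative eigenvalues, and the resonances in the closed lower half-plane). There is an absolute constant $C$ with $0<C\le2^5$ such that in each of the three cases, for every such $q$ and every $p>1$, $$\sum_{\operatorname{Im}k_n\le0}\frac1{|k_n-2i|^{p}}\le C\,Y_p\Bigl(1+\frac{\gamma}{\pi}+\mathcal Q\Bigr)\quad\text{and}\quad \sum_{\operatorname{Im}k_n\ge0}\frac1{|k_n+2i|^{p}}\le C\,Y_p\Bigl(1+\frac{\gamma}{\pi}+\mathcal Q\Bigr),\qquad Y_p=\sqrt\pi\,\frac{\Gamma\left(\frac{p-1}2\right)}{\Gamma\left(\frac p2\right)}.$$ -/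

import Mathlib

open MeasureTheory Topology
open scoped ENNReal

noncomputable section

/-- The support of an integrable function `q` on the line (insensitive to null sets): the points
none of whose neighbourhoods `q` vanishes almost everywhere on. -/
def essSupport (q : ℝ → ℝ) : Set ℝ :=
  {x | ∀ U ∈ 𝓝 x, ¬ ∀ᵐ y ∂(volume : Measure ℝ), y ∈ U → q y = 0}

/-- `supp q ⊆ [0, γ]`, but `supp q` lies in no shorter compact interval. For `q ≠ 0` this says
that `[0, γ]` is the convex hull of `supp q`; for `q = 0` it says that `γ = 0`. -/
def HasSupportInterval (q : ℝ → ℝ) (γ : ℝ) : Prop :=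
  0 ≤ γ ∧ essSupport q ⊆ Set.Icc 0 γ ∧
    ∀ a b : ℝ, a ≤ b → essSupport q ⊆ Set.Icc a b → γ ≤ b - a

/-- `f` solves `-f'' + q f = k² f` on the line. As `q` is only locally integrable, this means that
`f` is differentiable, `f'` is locally absolutely continuous and the equation holds almost
everywhere, that is, `f'` is an indefinite integral of `(q - k²) f`. -/
def IsSchrodingerSolution (q : ℝ → ℝ) (k : ℂ) (f : ℝ → ℂ) : Prop :=
  Differentiable ℝ f ∧
    ∀ a b : ℝ, deriv f b - deriv f a = ∫ x in a..b, ((q x : ℂ) - k ^ 2) * f x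

/-- `f` is the Jost solution `ψ₊(·, k)`: it equals `e^{ikx}` for large positive `x`. -/
def IsJostPlus (q : ℝ → ℝ) (k : ℂ) (f : ℝ → ℂ) : Prop :=
  IsSchrodingerSolution q k f ∧
    ∃ R : ℝ, ∀ x : ℝ, R ≤ x → f x = Complex.exp (Complex.I * k * (x : ℂ))

/-- `f` is the Jost solution `ψ₋(·, k)`: it equals `e^{-ikx}` for large negative `x`. -/
def IsJostMinus (q : ℝ → ℝ) (k : ℂ) (f : ℝ → ℂ) : Prop :=
  IsSchrodingerSolution q k f ∧
    ∃ R : ℝ, ∀ x : ℝ, x ≤ R → f x = Complex.exp (-(Complex.I * k * (x : ℂ)))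

/-- The Jost solution `ψ₊(·, k)`. -/
def jostPlus (q : ℝ → ℝ) (k : ℂ) : ℝ → ℂ := Classical.epsilon (IsJostPlus q k)

/-- The Jost solution `ψ₋(·, k)`. -/
def jostMinus (q : ℝ → ℝ) (k : ℂ) : ℝ → ℂ := Classical.epsilon (IsJostMinus q k)

/-- The Wronskian `w(k) = {ψ₋(·, k), ψ₊(·, k)}` with `{f, g} = f g' - f' g`. The Wronskian of two
solutions of the same equation does not depend on the point; it is evaluated at `0`. -/
def jostWronskian (q : ℝ → ℝ) (k : ℂ) : ℂ :=
  jostMinus q k 0 * deriv (jostPlus q k) 0 - deriv (jostMinus q k) 0 * jostPlus q k 0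

/-- The Jost function `ψ₊(0, k)` of the half-line problem with `f(0) = 0`. -/
def jostDirichlet (q : ℝ → ℝ) (k : ℂ) : ℂ := jostPlus q k 0

/-- The Jost function `ψ₊'(0, k)` of the half-line problem with `f'(0) = 0`. -/
def jostNeumann (q : ℝ → ℝ) (k : ℂ) : ℂ := deriv (jostPlus q k) 0

/-- `∑ |k_n - 2i|^{-p}` over the zeros `k_n` of `F` with `Im k_n ≤ 0`, counted with
multiplicity. -/
def lowerZeroSum (F : ℂ → ℂ) (p : ℝ) : ℝ≥0∞ :=
  ∑' k : {k : ℂ // F k = 0 ∧ k.im ≤ 0},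
    (analyticOrderAt F (k : ℂ) : ℝ≥0∞) * ENNReal.ofReal (‖(k : ℂ) - 2 * Complex.I‖ ^ (-p))

/-- `∑ |k_n + 2i|^{-p}` over the zeros `k_n` of `F` with `Im k_n ≥ 0`, counted with
multiplicity. -/
def upperZeroSum (F : ℂ → ℂ) (p : ℝ) : ℝ≥0∞ :=
  ∑' k : {k : ℂ // F k = 0 ∧ 0 ≤ k.im},
    (analyticOrderAt F (k : ℂ) : ℝ≥0∞) * ENNReal.ofReal (‖(k : ℂ) + 2 * Complex.I‖ ^ (-p))

/-- `F` is entire, and for every `p > 1` both zero sums are at most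
`C Y_p (1 + γ/π + Q)`, where `Y_p = √π Γ((p-1)/2) / Γ(p/2)`. -/
def ZeroSumBound (F : ℂ → ℂ) (C γ Q : ℝ) : Prop :=
  Differentiable ℂ F ∧ ∀ p : ℝ, 1 < p →
    lowerZeroSum F p ≤ ENNReal.ofReal
      (C * (√Real.pi * Real.Gamma ((p - 1) / 2) / Real.Gamma (p / 2)) * (1 + γ / Real.pi + Q)) ∧
    upperZeroSum F p ≤ ENNReal.ofReal
      (C * (√Real.pi * Real.Gamma ((p - 1) / 2) / Real.Gamma (p / 2)) * (1 + γ / Real.pi + Q))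

end

/-! An entire function of exponential type has at most linearly many zeros in large discs, and a
linear counting function bounds the power sums for every p > 1. What must be controlled is the
constant, hence both the growth of F and a lower bound for F at one point.

Growth: factor the equation through f' ± ikf, use variation of constants from γ back to 0, and apply
Gronwall with the weight e^{|Im k| x}. This gives `IsJostPlus.norm_le`, of type 2γ with a factor
exp(‖q‖/|k|), which is harmless once |k| ≥ 1.

Lower bound: for real k the Wronskian of ψ₊ and its conjugate is constant, so Im(ψ₊' · conj ψ₊) = k.
At k = 1 this forces |w(1)| ≥ 2; combined with the upper bound at k = 1 it gives |ψ₊(0,1)|,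
|ψ₊'(0,1)| ≥ e^{-‖q‖} (`IsJostPlus.norm_bounds_one`). Thus Case 1 costs one ‖q‖ in the exponent, and
Cases 2 and 3 cost two.

Counting: Jensen's inequality centred at 1 (`sum_analyticOrderAt_le`), then summation by parts
(`sum_mul_rpow_le`) and a Gamma-ratio estimate (`mul_rpow_div_le_Gamma_ratio`);
`zeroSumBound_of_growth` joins these for all three cases.

Entirety: ψ₊ is a Neumann-type solution of a fixed-point equation in an exponentially weighted
space, analytic in k on each disc (`exists_jost_family`); uniqueness glues the discs together. -/

/-! ### Absolute continuity and the integrated product rule -/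

theorem AbsolutelyContinuousOnInterval.ofReal {f : ℝ → ℝ} {a b : ℝ}
    (hf : AbsolutelyContinuousOnInterval f a b) :
    AbsolutelyContinuousOnInterval (fun x => (f x : ℂ)) a b := by
  unfold AbsolutelyContinuousOnInterval at *
  simpa only [Complex.dist_eq, ← Complex.ofReal_sub, Complex.norm_real, Real.dist_eq,
    Real.norm_eq_abs] using hf

theorem absolutelyContinuousOnInterval_integral_complex {g : ℝ → ℂ} {a b : ℝ}
    (hg : IntervalIntegrable g volume a b) :
    AbsolutelyContinuousOnInterval (fun x => ∫ t in a..x, g t) a b := by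
  have hr : IntervalIntegrable (fun t => (g t).re) volume a b :=
    ⟨hg.1.re, hg.2.re⟩
  have hi : IntervalIntegrable (fun t => (g t).im) volume a b :=
    ⟨hg.1.im, hg.2.im⟩
  have h1 := (hr.absolutelyContinuousOnInterval_intervalIntegral Set.left_mem_uIcc).ofReal
  have h2 := ((hi.absolutelyContinuousOnInterval_intervalIntegral
    Set.left_mem_uIcc).ofReal).const_smul Complex.I
  have h3 := h1.add h2
  have key : ∀ x ∈ Set.uIcc a b, (∫ t in a..x, g t) =
      ((∫ t in a..x, (g t).re : ℝ) : ℂ) + Complex.I • ((∫ t in a..x, (g t).im : ℝ) : ℂ) := by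
    intro x hx
    have hs : Set.uIcc a x ⊆ Set.uIcc a b := Set.uIcc_subset_uIcc_left hx
    rw [← intervalIntegral.integral_ofReal, ← intervalIntegral.integral_ofReal, smul_eq_mul,
      ← intervalIntegral.integral_const_mul, ← intervalIntegral.integral_add]
    · refine intervalIntegral.integral_congr fun t _ => ?_
      rw [mul_comm, Complex.re_add_im]
    · exact ⟨(hr.mono_set hs).1.ofReal, (hr.mono_set hs).2.ofReal⟩
    · exact IntervalIntegrable.const_mul ⟨(hi.mono_set hs).1.ofReal, (hi.mono_set hs).2.ofReal⟩ _
  rw [absolutelyContinuousOnInterval_iff] at h3 ⊢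
  intro ε hε
  obtain ⟨δ, hδ, h⟩ := h3 ε hε
  refine ⟨δ, hδ, fun E hE hl => ?_⟩
  have := h E hE hl
  refine lt_of_eq_of_lt (Finset.sum_congr rfl fun i hi => ?_) this
  have hm := hE.1 i hi
  simp only [Pi.add_apply]
  rw [key _ hm.1, key _ hm.2]

/-- The product rule, integrated, for a `C¹` function and an indefinite integral. -/
theorem integral_product_rule {e e' h g : ℝ → ℂ} (he : ∀ x, HasDerivAt e (e' x) x)
    (he' : Continuous e') (hg : ∀ a b, IntervalIntegrable g volume a b)
    (hh : ∀ a b, h b - h a = ∫ t in a..b, g t) (a b : ℝ) :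
    e b * h b - e a * h a = ∫ t in a..b, (e' t * h t + e t * g t) := by
  have hec : Continuous e := continuous_iff_continuousAt.2 fun x => (he x).continuousAt
  have hform : h = fun x => h a + ∫ t in a..x, g t := by
    funext x; rw [← hh a x]; ring
  have hhc : Continuous h := by
    rw [hform]; exact continuous_const.add (intervalIntegral.continuous_primitive hg a)
  have heform : e = fun x => e a + ∫ t in a..x, e' t := by
    funext x
    rw [intervalIntegral.integral_eq_sub_of_hasDerivAt (fun t _ => he t)
      (he'.intervalIntegrable _ _)]
    ring
  have hI : IntervalIntegrable (fun t => e' t * h t + e t * g t) volume a b :=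
    ((he'.mul hhc).intervalIntegrable _ _).add ((hg a b).continuousOn_mul hec.continuousOn)
  have hconst : ∀ c : ℂ, AbsolutelyContinuousOnInterval (fun _ : ℝ => c) a b := fun c =>
    (LipschitzWith.const c).lipschitzOnWith.absolutelyContinuousOnInterval
  have hac1 : AbsolutelyContinuousOnInterval e a b := by
    rw [heform]
    exact (hconst _).add
      (absolutelyContinuousOnInterval_integral_complex (he'.intervalIntegrable _ _))
  have hac2 : AbsolutelyContinuousOnInterval h a b := by
    rw [hform]
    exact (hconst _).add (absolutelyContinuousOnInterval_integral_complex (hg a b))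
  -- `h` is differentiable only almost everywhere, so the fundamental theorem is replaced by this:
  -- an absolutely continuous function with a.e. zero derivative is constant.
  have hac := (hac1.fun_smul hac2).sub (absolutelyContinuousOnInterval_integral_complex hI)
  obtain ⟨C, hC⟩ := hac.const_of_ae_hasDerivAt_zero (by
    filter_upwards [hI.ae_hasDerivAt_integral, (hg a b).ae_hasDerivAt_integral] with x hx1 hx2 hx
    have d1 := hx1 hx a Set.left_mem_uIcc
    have d2 := (hx2 hx a Set.left_mem_uIcc).const_add (h a)
    rw [← hform] at d2
    have d3 := ((he x).smul d2).sub d1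
    have hz : e x • g x + e' x • h x - (e' x * h x + e x * g x) = 0 := by
      simp only [smul_eq_mul]
      ring
    rwa [hz] at d3)
  have ha := hC a Set.left_mem_uIcc
  have hb := hC b Set.right_mem_uIcc
  simp only [Pi.sub_apply, smul_eq_mul, intervalIntegral.integral_same] at ha hb
  linear_combination hb - ha

/-! ### Gronwall's inequality, null sets off the support, and unique continuation -/

/-- Gronwall's inequality in integral form, with an integrable kernel. -/
theorem gronwall_integral {g α : ℝ → ℝ} {c X R : ℝ} (hXR : X ≤ R)
    (hα : IntervalIntegrable α volume X R) (hα0 : ∀ t, 0 ≤ α t) (hg0 : ∀ t, 0 ≤ g t)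
    (hαg : IntervalIntegrable (fun t => α t * g t) volume X R)
    (hle : ∀ x ∈ Set.Icc X R, g x ≤ c + ∫ t in x..R, α t * g t) :
    g X ≤ c * Real.exp (∫ t in X..R, α t) := by
  have sub : ∀ {x y}, x ∈ Set.Icc X R → y ∈ Set.Icc X R → Set.uIcc x y ⊆ Set.uIcc X R := by
    intro x y hx hy
    rw [Set.uIcc_of_le hXR]
    exact Set.uIcc_subset_Icc hx hy
  have hRm : R ∈ Set.Icc X R := ⟨hXR, le_rfl⟩
  have hXm : X ∈ Set.Icc X R := ⟨le_rfl, hXR⟩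
  set H : ℝ → ℝ := fun x => ∫ t in x..R, α t with hH
  set h : ℝ → ℝ := fun x => c + ∫ t in x..R, α t * g t with hh
  have Hsub : ∀ {x y}, x ∈ Set.Icc X R → y ∈ Set.Icc X R →
      H x - H y = ∫ t in x..y, α t := by
    intro x y hx hy
    have := intervalIntegral.integral_add_adjacent_intervals (hα.mono_set (sub hx hy))
          (hα.mono_set (sub hy hRm))
    simp only [hH]
    linarith
  have hsub : ∀ {x y}, x ∈ Set.Icc X R → y ∈ Set.Icc X R →
      h x - h y = ∫ t in x..y, α t * g t := by
    intro x y hx hy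
    have := intervalIntegral.integral_add_adjacent_intervals (hαg.mono_set (sub hx hy))
          (hαg.mono_set (sub hy hRm))
    simp only [hh]
    linarith
  have Hnn : ∀ {x}, x ∈ Set.Icc X R → 0 ≤ H x := fun hx =>
    intervalIntegral.integral_nonneg hx.2 fun t _ => hα0 t
  have hanti : ∀ {x y}, x ∈ Set.Icc X R → y ∈ Set.Icc X R → x ≤ y → h y ≤ h x := by
    intro x y hx hy hxy
    have := intervalIntegral.integral_nonneg (μ := volume) hxy
      fun t _ => mul_nonneg (hα0 t) (hg0 t)
    linarith [hsub hx hy]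
  have hnn : ∀ {x}, x ∈ Set.Icc X R → 0 ≤ h x := fun hx => (hg0 _).trans (hle _ hx)
  have step : ∀ {x y}, x ∈ Set.Icc X R → y ∈ Set.Icc X R → x ≤ y →
      h x * (1 - (H x - H y)) ≤ h y := by
    intro x y hx hy hxy
    have : ∫ t in x..y, α t * g t ≤ ∫ t in x..y, α t * h x := by
      refine intervalIntegral.integral_mono_on hxy (hαg.mono_set (sub hx hy))
        ((hα.mono_set (sub hx hy)).mul_const _) fun t ht => ?_
      have htm : t ∈ Set.Icc X R := ⟨hx.1.trans ht.1, ht.2.trans hy.2⟩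
      exact mul_le_mul_of_nonneg_left ((hle t htm).trans (hanti hx htm ht.1)) (hα0 t)
    rw [intervalIntegral.integral_mul_const, ← hsub hx hy, ← Hsub hx hy] at this
    linarith
  have Hcont : ContinuousOn H (Set.Icc X R) := by
    have := intervalIntegral.continuousOn_primitive_interval_left
      (μ := volume) (f := α) (a := X) (b := R) (by rw [Set.uIcc_of_le hXR]; exact
        (intervalIntegrable_iff_integrableOn_Icc_of_le hXR).1 hα)
    rwa [Set.uIcc_of_le hXR] at this
  -- Discrete Gronwall: `[x, R]` is cut into pieces of α-mass at most δ, each costing a factor 1 -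
  -- δ. The cut points come from the intermediate value theorem for `H`, since α itself is merely
  -- integrable.
  have ind : ∀ (δ : ℝ), 0 ≤ δ → δ < 1 → ∀ n : ℕ, ∀ x ∈ Set.Icc X R, H x ≤ n * δ →
      h x * (1 - δ) ^ n ≤ c := by
    intro δ h0 h1 n
    induction n with
    | zero =>
      intro x hx hHx
      have h2 := step hx hRm hx.2
      have h3 : H R = 0 := by simp [hH]
      have h4 : h R = c := by simp [hh]
      have h5 : H x = 0 := le_antisymm (by simpa using hHx) (Hnn hx)
      rw [h3, h4, h5] at h2
      simpa using h2
    | succ n ih =>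
      intro x hx hHx
      have hsubset : Set.Icc x R ⊆ Set.Icc X R := Set.Icc_subset_Icc_left hx.1
      have h3 : H R = 0 := by simp [hH]
      obtain ⟨y, hy, hyH⟩ := intermediate_value_Icc' hx.2 (Hcont.mono hsubset)
        (show max (H x - δ) 0 ∈ Set.Icc (H R) (H x) by
          rw [h3]
          exact ⟨le_max_right _ _, max_le (by linarith) (Hnn hx)⟩)
      have hy' := hsubset hy
      have h4 := ih y hy' (by
        rw [hyH]
        push_cast at hHx
        exact max_le (by linarith) (by positivity))
      have h5 := step hx hy' hy.1
      have h6 : H x - H y ≤ δ := by rw [hyH]; linarith [le_max_left (H x - δ) 0]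
      have h7 : h x * (1 - δ) ≤ h y :=
        (mul_le_mul_of_nonneg_left (by linarith) (hnn hx)).trans h5
      calc h x * (1 - δ) ^ (n + 1) = h x * (1 - δ) * (1 - δ) ^ n := by ring
        _ ≤ h y * (1 - δ) ^ n := mul_le_mul_of_nonneg_right h7 (pow_nonneg (by linarith) _)
        _ ≤ c := h4
  -- With δ = H(X)/n the product of the n factors tends to e^{-H(X)}.
  have lim := (Real.tendsto_one_add_div_pow_exp (-(H X))).const_mul (h X)
  have hfin : h X * Real.exp (-(H X)) ≤ c := by
    refine le_of_tendsto lim ?_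
    obtain ⟨N, hN⟩ := exists_nat_gt (H X)
    filter_upwards [Filter.eventually_gt_atTop N] with n hn
    have hn' : H X < n := hN.trans (by exact_mod_cast hn)
    have hn0 : (0 : ℝ) < n := (Hnn hXm).trans_lt hn'
    have := ind (H X / n) (div_nonneg (Hnn hXm) hn0.le) ((div_lt_one hn0).2 hn') n X hXm
      (by field_simp; exact le_rfl)
    rwa [neg_div, ← sub_eq_add_neg]
  calc g X ≤ h X := hle X hXm
    _ = h X * Real.exp (-(H X)) * Real.exp (H X) := by
      rw [mul_assoc, ← Real.exp_add]; simp
    _ ≤ c * Real.exp (H X) := mul_le_mul_of_nonneg_right hfin (Real.exp_pos _).le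

/-- A locally null set in a second countable space is null. -/
theorem ae_eq_zero_of_notMem_essSupport (q : ℝ → ℝ) : ∀ᵐ y, y ∉ essSupport q → q y = 0 := by
  rw [ae_iff]
  refine measure_null_of_locally_null _ fun x hx => ?_
  simp only [Classical.not_imp, Set.mem_ofPred_eq] at hx
  obtain ⟨hx1, -⟩ := hx
  simp only [essSupport, Set.mem_ofPred_eq, not_forall, not_not] at hx1
  obtain ⟨U, hU, h⟩ := hx1
  refine ⟨_, inter_mem_nhdsWithin _ hU, measure_mono_null ?_ h⟩
  rintro y ⟨hy, hyU⟩
  simp only [Classical.not_imp, Set.mem_ofPred_eq] at hy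
  exact fun h => hy.2 (h hyU)

/-- A solution of `d'' = p d` on `[X, ∞)` that vanishes for large `x` vanishes identically. -/
theorem eq_zero_of_eventually_eq_zero {p : ℝ → ℂ} {d : ℝ → ℂ} {X R : ℝ}
    (hp : ∀ a b, IntervalIntegrable p volume a b) (hd : Differentiable ℝ d)
    (heq : ∀ a b, X ≤ a → X ≤ b → deriv d b - deriv d a = ∫ t in a..b, p t * d t)
    (hz : ∀ x, R ≤ x → d x = 0) : ∀ x, X ≤ x → d x = 0 ∧ deriv d x = 0 := by
  have hz' : ∀ x, R < x → deriv d x = 0 := by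
    intro x hx
    have : d =ᶠ[𝓝 x] fun _ => 0 := by
      filter_upwards [lt_mem_nhds hx] with y hy using hz y hy.le
    rw [this.deriv_eq]
    simp
  have hpd : ∀ a b, IntervalIntegrable (fun t => p t * d t) volume a b := fun a b =>
    (hp a b).mul_continuousOn hd.continuous.continuousOn
  intro x hx
  -- The margin 1 puts `S` strictly beyond `R`, where the derivative vanishes too.
  set S : ℝ := max x (R + 1) with hS
  have hxS : x ≤ S := le_max_left _ _
  have hRS : R + 1 ≤ S := le_max_right _ _
  have hdS : d S = 0 := hz S (by linarith)
  have hdS' : deriv d S = 0 := hz' S (by linarith)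
  have hder : ∀ y, X ≤ y → deriv d y = - ∫ t in y..S, p t * d t := by
    intro y hy
    rw [← heq y S hy (hx.trans hxS), hdS']
    ring
  have hdercont : ContinuousOn (deriv d) (Set.Icc x S) := by
    have h1 : Continuous fun y => deriv d S - ∫ t in y..S, p t * d t := by
      simp_rw [fun y => intervalIntegral.integral_symm (μ := volume) (f := fun t => p t * d t) S y]
      exact continuous_const.sub (intervalIntegral.continuous_primitive hpd S).neg
    refine h1.continuousOn.congr fun y hy => ?_
    rw [hder y (hx.trans hy.1), hdS']
    ring
  have hdint : ∀ y ∈ Set.Icc x S, d y = - ∫ t in y..S, deriv d t := by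
    intro y hy
    rw [intervalIntegral.integral_deriv_eq_sub (fun t _ => hd t), hdS]
    · ring
    · refine ContinuousOn.intervalIntegrable ?_
      rw [Set.uIcc_of_le hy.2]
      exact hdercont.mono (Set.Icc_subset_Icc_left hy.1)
  -- For the first-order system in (d, d') the quantity |d| + |d'| obeys Gronwall with kernel 1 +
  -- |p| and zero data at `S`.
  set α : ℝ → ℝ := fun t => 1 + ‖p t‖ with hα
  set g : ℝ → ℝ := fun t => ‖d t‖ + ‖deriv d t‖ with hg
  have hαi : ∀ a b, IntervalIntegrable α volume a b := fun a b =>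
    intervalIntegrable_const.add (hp a b).norm
  have hgc : ContinuousOn g (Set.Icc x S) := hd.continuous.continuousOn.norm.add hdercont.norm
  have hsub : ∀ y ∈ Set.Icc x S, Set.uIcc y S ⊆ Set.Icc x S := fun y hy => by
    rw [Set.uIcc_of_le hy.2]
    exact Set.Icc_subset_Icc_left hy.1
  have hαg : ∀ y ∈ Set.Icc x S, IntervalIntegrable (fun t => α t * g t) volume y S := fun y hy =>
    (hαi y S).mul_continuousOn (hgc.mono (hsub y hy))
  have hα0 : ∀ t, 0 ≤ α t := fun t => by positivity
  have hg0 : ∀ t, 0 ≤ g t := fun t => by positivity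
  have main := gronwall_integral (c := 0) hxS (hαi x S) hα0 hg0 (hαg x ⟨le_rfl, hxS⟩) (by
    intro y hy
    have i1 : IntervalIntegrable (fun t => ‖deriv d t‖) volume y S :=
      (hdercont.norm.mono (hsub y hy)).intervalIntegrable
    have i2 : IntervalIntegrable (fun t => ‖p t * d t‖) volume y S := (hpd y S).norm
    have e1 : ‖d y‖ ≤ ∫ t in y..S, ‖deriv d t‖ := by
      rw [hdint y hy, norm_neg]
      exact intervalIntegral.norm_integral_le_integral_norm hy.2
    have e2 : ‖deriv d y‖ ≤ ∫ t in y..S, ‖p t * d t‖ := by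
      rw [hder y (hx.trans hy.1), norm_neg]
      exact intervalIntegral.norm_integral_le_integral_norm hy.2
    have e3 : (∫ t in y..S, (‖deriv d t‖ + ‖p t * d t‖)) ≤ ∫ t in y..S, α t * g t := by
      refine intervalIntegral.integral_mono_on hy.2 (i1.add i2) (hαg y hy) fun t _ => ?_
      simp only [hα, hg, norm_mul]
      nlinarith [norm_nonneg (d t), norm_nonneg (deriv d t), norm_nonneg (p t),
        mul_nonneg (norm_nonneg (p t)) (norm_nonneg (deriv d t))]
    rw [intervalIntegral.integral_add i1 i2] at e3
    simp only [hg] at e3 ⊢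
    linarith)
  rw [zero_mul] at main
  have h1 := norm_nonneg (d x)
  have h2 := norm_nonneg (deriv d x)
  simp only [hg] at main
  exact ⟨norm_eq_zero.1 (by linarith), norm_eq_zero.1 (by linarith)⟩

/-! ### Existence of the Jost solution and analyticity in k -/

theorem hasDerivAt_cexp_mul (c : ℂ) (x : ℝ) :
    HasDerivAt (fun x : ℝ => Complex.exp (c * x)) (c * Complex.exp (c * x)) x := by
  have h1 : HasDerivAt (fun x : ℝ => c * (x : ℂ)) (c * 1) x :=
    (Complex.ofRealCLM.hasDerivAt (x := x)).const_mul _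
  simpa only [mul_one, mul_comm] using h1.cexp

theorem differentiableAt_inverse_one_sub {𝔸 : Type*} [NormedRing 𝔸] [NormedAlgebra ℂ 𝔸]
    [CompleteSpace 𝔸] {g : ℂ → 𝔸} {k : ℂ} (hg : DifferentiableAt ℂ g k) (hu : IsUnit (1 - g k)) :
    DifferentiableAt ℂ (fun k => Ring.inverse (1 - g k)) k :=
  DifferentiableAt.comp k (g := Ring.inverse) (differentiableAt_inverse hu) (hg.const_sub 1)

open BoundedContinuousFunction in
/-- The operator `f ↦ ∫ₓᴿ e^{κ(x-t)} p(t) f(t) dt` on bounded continuous functions. -/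
theorem exists_weightedTail {κ R c : ℝ} {p : ℝ → ℂ}
    (hp : ∀ a b, IntervalIntegrable p volume a b) (hc0 : 0 ≤ c)
    (hc : ∀ x ≤ R, ∫ t in x..R, Real.exp (κ * (x - t)) * ‖p t‖ ≤ c) :
    ∃ T : BoundedContinuousFunction ℝ ℂ →L[ℂ] BoundedContinuousFunction ℝ ℂ, ‖T‖ ≤ c ∧
      ∀ f x, T f x = (Real.exp (κ * x) : ℂ) *
        ∫ t in (min x R)..R, (Real.exp (-(κ * t)) : ℂ) * p t * f t := by
  have hwc : Continuous fun t : ℝ => (Real.exp (-(κ * t)) : ℂ) := by fun_prop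
  have hi : ∀ (f : BoundedContinuousFunction ℝ ℂ) a b,
      IntervalIntegrable (fun t => (Real.exp (-(κ * t)) : ℂ) * p t * f t) volume a b :=
    fun f a b => ((hp a b).continuousOn_mul hwc.continuousOn).mul_continuousOn
      f.continuous.continuousOn
  have hcont : ∀ f : BoundedContinuousFunction ℝ ℂ, Continuous fun x : ℝ =>
      (Real.exp (κ * x) : ℂ) * ∫ t in (min x R)..R, (Real.exp (-(κ * t)) : ℂ) * p t * f t := by
    intro f
    refine Continuous.mul (by fun_prop) ?_
    simp_rw [fun y => intervalIntegral.integral_symm (μ := volume)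
      (f := fun t => (Real.exp (-(κ * t)) : ℂ) * p t * f t) R y]
    exact ((intervalIntegral.continuous_primitive (hi f) R).comp
      (continuous_id.min continuous_const)).neg
  have hbound : ∀ (f : BoundedContinuousFunction ℝ ℂ) (x : ℝ),
      ‖(Real.exp (κ * x) : ℂ) * ∫ t in (min x R)..R, (Real.exp (-(κ * t)) : ℂ) * p t * f t‖
        ≤ c * ‖f‖ := by
    intro f x
    rcases le_total R x with h | h
    · rw [min_eq_right h, intervalIntegral.integral_same, mul_zero, norm_zero]
      positivity
    · rw [min_eq_left h, ← intervalIntegral.integral_const_mul]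
      have hi1 : IntervalIntegrable (fun t => Real.exp (κ * (x - t)) * ‖p t‖) volume x R :=
        (hp x R).norm.continuousOn_mul (by fun_prop)
      calc _ ≤ ∫ t in x..R, Real.exp (κ * (x - t)) * ‖p t‖ * ‖f‖ := by
            refine intervalIntegral.norm_integral_le_of_norm_le h (ae_of_all _ fun t _ => ?_)
              (hi1.mul_const _)
            rw [norm_mul, norm_mul, norm_mul, Complex.norm_real, Complex.norm_real,
              Real.norm_of_nonneg (Real.exp_pos _).le, Real.norm_of_nonneg (Real.exp_pos _).le,
              ← mul_assoc, ← mul_assoc, ← Real.exp_add, show κ * x + -(κ * t) = κ * (x - t) by ring]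
            exact mul_le_mul_of_nonneg_left (f.norm_coe_le_norm t) (by positivity)
        _ = (∫ t in x..R, Real.exp (κ * (x - t)) * ‖p t‖) * ‖f‖ :=
            intervalIntegral.integral_mul_const _ _
        _ ≤ c * ‖f‖ := mul_le_mul_of_nonneg_right (hc x h) (norm_nonneg _)
  let L : BoundedContinuousFunction ℝ ℂ →ₗ[ℂ] BoundedContinuousFunction ℝ ℂ :=
    { toFun := fun f => ofNormedAddCommGroup _ (hcont f) (c * ‖f‖) (hbound f)
      map_add' := fun f g => by
        ext x
        simp only [coe_ofNormedAddCommGroup, coe_add, Pi.add_apply, mul_add]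
        rw [intervalIntegral.integral_add (hi f _ _) (hi g _ _), mul_add]
      map_smul' := fun a f => by
        ext x
        simp only [coe_ofNormedAddCommGroup, coe_smul, smul_eq_mul, RingHom.id_apply]
        rw [mul_left_comm, ← intervalIntegral.integral_const_mul a]
        congr 1
        refine intervalIntegral.integral_congr fun t _ => ?_
        change _ * _ * (a * f t) = a * (_ * _ * f t)
        ring }
  refine ⟨L.mkContinuous c fun f => ?_, L.mkContinuous_norm_le hc0 _, fun f x => rfl⟩
  exact norm_ofNormedAddCommGroup_le _ (by positivity) (hbound f)

/-- `e^{(κ + ik)x}`, frozen outside `[-R, R]`, as an entire family of bounded functions. -/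
theorem exists_truncated_exp (κ R : ℝ) (hR : 0 ≤ R) :
    ∃ E : ℂ → BoundedContinuousFunction ℝ ℂ, Differentiable ℂ E ∧
      ∀ k, ∀ x, |x| ≤ R → E k x = Complex.exp ((κ + Complex.I * k) * x) := by
  let m : BoundedContinuousFunction ℝ ℂ := BoundedContinuousFunction.ofNormedAddCommGroup
    (fun x : ℝ => ((max (-R) (min x R) : ℝ) : ℂ)) (by fun_prop) R (fun x => by
      rw [Complex.norm_real, Real.norm_eq_abs, abs_le]
      exact ⟨le_max_left _ _, max_le (by linarith) (min_le_right _ _)⟩)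
  refine ⟨fun k => NormedSpace.exp ((κ + Complex.I * k) • m), ?_, ?_⟩
  · intro k
    have h1 := (hasDerivAt_exp_smul_const (𝕂 := ℂ) m (κ + Complex.I * k)).differentiableAt
    exact h1.comp k (f := fun k : ℂ => (κ + Complex.I * k : ℂ)) (by fun_prop)
  · intro k x hx
    let ev : BoundedContinuousFunction ℝ ℂ →+* ℂ :=
      { toFun := fun f => f x
        map_one' := rfl
        map_mul' := fun _ _ => rfl
        map_zero' := rfl
        map_add' := fun _ _ => rfl }
    have hev : Continuous ev := continuous_eval_const x
    have := NormedSpace.map_exp ev hev ((κ + Complex.I * k) • m)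
    change ev (NormedSpace.exp ((κ + Complex.I * k) • m)) = _
    rw [this, ← Complex.exp_eq_exp_ℂ]
    congr 1
    change (κ + Complex.I * k) * ((max (-R) (min x R) : ℝ) : ℂ) = _
    rw [min_eq_left (abs_le.1 hx).2, max_eq_right (abs_le.1 hx).1]

/-- Write ψ₊ = e^{ikx} + χ and η = -χ'. Then χ is the tail integral of η, and η that of (q - k²)χ +
q e^{ikx}. After multiplication by e^{κx} both become bounded functions `f`, `h` with f = J h and h
= (K - k²J) f + K E. Large κ makes `J` small, so 1 - J(K - k²J) is invertible for |k| < M, and its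
inverse is analytic in k. -/
theorem exists_jost_family {q : ℝ → ℝ} (hq : Integrable q) {R : ℝ} (hR0 : 0 ≤ R)
    (hR : ∀ᵐ t, R < |t| → q t = 0) (M : ℝ) :
    ∃ u : ℂ → ℝ → ℂ, (∀ k, ‖k‖ < M → IsJostPlus q k (u k)) ∧
      ∀ x, DifferentiableOn ℂ (fun k => u k x) (Metric.ball 0 M) ∧
        DifferentiableOn ℂ (fun k => deriv (u k) x) (Metric.ball 0 M) := by
  set N : ℝ := ∫ t, |q t| with hN
  have hN0 : 0 ≤ N := integral_nonneg fun t => abs_nonneg _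
  -- Since ‖J‖ ≤ 1/κ ≤ 1 and ‖K‖ ≤ N, the product has norm at most (N + M²)/κ < 1.
  set κ : ℝ := N + M ^ 2 + 1 with hκ
  have hκ1 : 1 ≤ κ := by rw [hκ]; nlinarith [sq_nonneg M]
  have hκ0 : 0 < κ := by linarith
  have hqc : Integrable fun t => (q t : ℂ) := hq.ofReal
  have hqi : ∀ a b, IntervalIntegrable (fun t => (q t : ℂ)) volume a b := fun a b =>
    hqc.intervalIntegrable
  obtain ⟨J, hJ, hJe⟩ := exists_weightedTail (κ := κ) (R := R) (c := 1 / κ) (p := fun _ => 1)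
    (fun a b => intervalIntegrable_const) (by positivity) (by
      intro x hx
      have : ∀ t ∈ Set.uIcc x R, HasDerivAt (fun t => -(1 / κ) * Real.exp (κ * (x - t)))
          (Real.exp (κ * (x - t)) * ‖(1 : ℂ)‖) t := by
        intro t _
        have h1 : HasDerivAt (fun t => κ * (x - t)) (κ * (0 - 1)) t :=
          ((hasDerivAt_const t x).sub (hasDerivAt_id t)).const_mul κ
        have h2 := (h1.exp).const_mul (-(1 / κ))
        have h3 : -(1 / κ) * (Real.exp (κ * (x - t)) * (κ * (0 - 1))) =
            Real.exp (κ * (x - t)) * ‖(1 : ℂ)‖ := by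
          rw [norm_one]
          field_simp
          ring
        rwa [h3] at h2
      rw [intervalIntegral.integral_eq_sub_of_hasDerivAt this
        (Continuous.intervalIntegrable (by fun_prop) _ _)]
      simp only [sub_self, mul_zero, Real.exp_zero]
      have : 0 ≤ 1 / κ * Real.exp (κ * (x - R)) := by positivity
      linarith)
  obtain ⟨K, hK, hKe⟩ := exists_weightedTail (κ := κ) (R := R) (c := N) (p := fun t => (q t : ℂ))
    hqi hN0 (by
      intro x hx
      have h1 : IntervalIntegrable (fun t => ‖(q t : ℂ)‖) volume x R := (hqi x R).norm
      calc _ ≤ ∫ t in x..R, ‖(q t : ℂ)‖ := by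
            refine intervalIntegral.integral_mono_on hx (h1.continuousOn_mul (by fun_prop)) h1
              fun t ht => ?_
            refine mul_le_of_le_one_left (norm_nonneg _) (Real.exp_le_one_iff.2 ?_)
            exact mul_nonpos_of_nonneg_of_nonpos hκ0.le (by linarith [ht.1])
        _ ≤ N := by
            rw [intervalIntegral.integral_of_le hx]
            simp only [Complex.norm_real, Real.norm_eq_abs]
            exact setIntegral_le_integral hq.abs (ae_of_all _ fun t => abs_nonneg _))
  obtain ⟨E, hE, hEe⟩ := exists_truncated_exp κ R hR0
  set A : ℂ → (BoundedContinuousFunction ℝ ℂ →L[ℂ] BoundedContinuousFunction ℝ ℂ) :=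
    fun k => K - k ^ 2 • J with hA
  have hAd : Differentiable ℂ A := by
    intro k
    exact (differentiableAt_const _).sub ((differentiableAt_id.pow 2).smul_const J)
  have hV : ∀ k, ‖k‖ < M → IsUnit (1 - J * A k) := by
    intro k hk
    refine isUnit_one_sub_of_norm_lt_one
      (R := BoundedContinuousFunction ℝ ℂ →L[ℂ] BoundedContinuousFunction ℝ ℂ) (x := J * A k) ?_
    have hk2 : ‖k ^ 2‖ ≤ M ^ 2 := by
      rw [norm_pow]; exact pow_le_pow_left₀ (norm_nonneg _) hk.le 2
    have hJ1 : ‖J‖ ≤ 1 := hJ.trans (by rw [div_le_one hκ0]; exact hκ1)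
    have h1 : ‖A k‖ ≤ N + M ^ 2 := by
      refine (norm_sub_le _ _).trans (add_le_add hK ?_)
      rw [norm_smul]
      calc ‖k ^ 2‖ * ‖J‖ ≤ M ^ 2 * 1 := mul_le_mul hk2 hJ1 (norm_nonneg _) (sq_nonneg _)
        _ = M ^ 2 := mul_one _
    calc ‖J * A k‖ ≤ ‖J‖ * ‖A k‖ := norm_mul_le _ _
      _ ≤ 1 / κ * (N + M ^ 2) := mul_le_mul hJ h1 (norm_nonneg _) (by positivity)
      _ < 1 := by
        rw [one_div_mul_eq_div, div_lt_one hκ0, hκ]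
        linarith
  set f : ℂ → BoundedContinuousFunction ℝ ℂ :=
    fun k => Ring.inverse (1 - J * A k) (J (K (E k))) with hf
  set h : ℂ → BoundedContinuousFunction ℝ ℂ := fun k => A k (f k) + K (E k) with hh
  have hfd : DifferentiableOn ℂ f (Metric.ball 0 M) := by
    intro k hk
    have hk' : ‖k‖ < M := by simpa using hk
    refine DifferentiableAt.differentiableWithinAt ?_
    have h2 : DifferentiableAt ℂ (fun k => Ring.inverse (1 - J * A k)) k :=
      differentiableAt_inverse_one_sub ((hAd k).const_mul J) (hV k hk')
    exact h2.clm_apply (J.differentiableAt.comp k (K.differentiableAt.comp k (hE k)))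
  have hhd : DifferentiableOn ℂ h (Metric.ball 0 M) := fun k hk =>
    ((hAd k).differentiableWithinAt.clm_apply (hfd k hk)).add
      (K.differentiableAt.comp k (hE k)).differentiableWithinAt
  have hfJ : ∀ k, ‖k‖ < M → f k = J (h k) := by
    intro k hk
    have h1 : ((1 - J * A k) * Ring.inverse (1 - J * A k)) (J (K (E k))) = J (K (E k)) := by
      rw [Ring.mul_inverse_cancel _ (hV k hk)]
      rfl
    have h2 : f k - J (A k (f k)) = J (K (E k)) := h1
    rw [hh, map_add, ← h2]
    abel
  set χ : ℂ → ℝ → ℂ := fun k x => (Real.exp (-(κ * x)) : ℂ) * f k x with hχ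
  set η : ℂ → ℝ → ℂ := fun k x => (Real.exp (-(κ * x)) : ℂ) * h k x with hη
  have hexp : ∀ x : ℝ, (Real.exp (-(κ * x)) : ℂ) * (Real.exp (κ * x) : ℂ) = 1 := by
    intro x
    rw [← Complex.ofReal_mul, ← Real.exp_add]
    simp
  have hηc : ∀ k, Continuous (η k) := fun k => by
    have := (h k).continuous
    simp only [hη]
    fun_prop
  have hχc : ∀ k, Continuous (χ k) := fun k => by
    have := (f k).continuous
    simp only [hχ]
    fun_prop
  have hχmin : ∀ k, ‖k‖ < M → ∀ x, χ k x = ∫ t in (min x R)..R, η k t := by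
    intro k hk x
    simp only [hχ]
    rw [hfJ k hk, hJe, ← mul_assoc, hexp, one_mul]
    simp only [mul_one, hη]
  have hqint : ∀ k a b, IntervalIntegrable
      (fun t => ((q t : ℂ) - k ^ 2) * χ k t + q t * Complex.exp (Complex.I * k * t)) volume a b :=
    fun k a b => (((hqi a b).sub intervalIntegrable_const).mul_continuousOn
      (hχc k).continuousOn).add ((hqi a b).mul_continuousOn (by fun_prop))
  have hηmin : ∀ k, ∀ x, η k x = ∫ t in (min x R)..R,
      (((q t : ℂ) - k ^ 2) * χ k t + q t * Complex.exp (Complex.I * k * t)) := by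
    intro k x
    simp only [hη, hh, hA]
    have i1 : ∀ a b, IntervalIntegrable (fun t => (Real.exp (-(κ * t)) : ℂ) * q t * f k t)
        volume a b := fun a b => ((hqi a b).continuousOn_mul (by fun_prop)).mul_continuousOn
        (f k).continuous.continuousOn
    have i2 : ∀ a b, IntervalIntegrable (fun t => (Real.exp (-(κ * t)) : ℂ) * 1 * f k t)
        volume a b := fun a b => Continuous.intervalIntegrable
          (((by fun_prop : Continuous fun t : ℝ => (Real.exp (-(κ * t)) : ℂ) * 1)).mul
            (f k).continuous) _ _
    have i3 : ∀ a b, IntervalIntegrable (fun t => (Real.exp (-(κ * t)) : ℂ) * q t * E k t)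
        volume a b := fun a b => ((hqi a b).continuousOn_mul (by fun_prop)).mul_continuousOn
        (E k).continuous.continuousOn
    have e1 : ((K - k ^ 2 • J) (f k) + K (E k)) x = K (f k) x - k ^ 2 * J (f k) x + K (E k) x :=
      rfl
    rw [e1, hKe, hKe, hJe, mul_left_comm (k ^ 2), ← mul_sub, ← mul_add, ← mul_assoc, hexp,
      one_mul, ← intervalIntegral.integral_const_mul, ← intervalIntegral.integral_sub (i1 _ _)
      ((i2 _ _).const_mul _), ← intervalIntegral.integral_add ((i1 _ _).sub ((i2 _ _).const_mul _))
      (i3 _ _)]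
    refine intervalIntegral.integral_congr_ae ?_
    filter_upwards [hR] with t ht _
    -- Freezing the exponential outside [-R, R] does no harm: `q` vanishes there almost everywhere.
    by_cases hqt : q t = 0
    · simp only [hqt, hχ]
      push_cast
      ring
    · have htR : |t| ≤ R := by
        by_contra hcon
        exact hqt (ht (not_le.1 hcon))
      rw [hEe k t htR, show ((κ : ℂ) + Complex.I * k) * t = (κ * t : ℝ) + Complex.I * k * t by
        push_cast; ring, Complex.exp_add, ← Complex.ofReal_exp]
      simp only [hχ]
      linear_combination (q t : ℂ) * Complex.exp (Complex.I * k * t) * hexp t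
  have hχ0 : ∀ k, ‖k‖ < M → ∀ x, R ≤ x → χ k x = 0 := by
    intro k hk x hx
    rw [hχmin k hk, min_eq_right hx, intervalIntegral.integral_same]
  have hη0 : ∀ k, ∀ x, R ≤ x → η k x = 0 := by
    intro k x hx
    rw [hηmin k, min_eq_right hx, intervalIntegral.integral_same]
  have hχint : ∀ k, ‖k‖ < M → ∀ x, χ k x = ∫ t in x..R, η k t := by
    intro k hk x
    rcases le_total x R with hx | hx
    · rw [hχmin k hk, min_eq_left hx]
    · rw [hχ0 k hk x hx, intervalIntegral.integral_symm, eq_comm, neg_eq_zero]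
      refine intervalIntegral.integral_zero_ae (ae_of_all _ fun t ht => hη0 k t ?_)
      rw [Set.uIoc_of_le hx] at ht
      exact ht.1.le
  have hηint : ∀ k, ‖k‖ < M → ∀ x, η k x = ∫ t in x..R,
      (((q t : ℂ) - k ^ 2) * χ k t + q t * Complex.exp (Complex.I * k * t)) := by
    intro k hk x
    rcases le_total x R with hx | hx
    · rw [hηmin k, min_eq_left hx]
    · rw [hη0 k x hx, intervalIntegral.integral_symm, eq_comm, neg_eq_zero]
      refine intervalIntegral.integral_zero_ae ?_
      filter_upwards [hR] with t ht hxt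
      rw [Set.uIoc_of_le hx] at hxt
      rw [hχ0 k hk t hxt.1.le, ht (hxt.1.trans_le (le_abs_self t))]
      simp
  have hexpd := fun k : ℂ => hasDerivAt_cexp_mul (Complex.I * k)
  set u : ℂ → ℝ → ℂ := fun k x => Complex.exp (Complex.I * k * x) + χ k x with hu
  have hud : ∀ k, ‖k‖ < M → ∀ x : ℝ, HasDerivAt (u k)
      (Complex.I * k * Complex.exp (Complex.I * k * x) - η k x) x := by
    intro k hk x
    have h1 : HasDerivAt (χ k) (-η k x) x := by
      rw [show χ k = fun x => ∫ t in x..R, η k t from funext (hχint k hk)]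
      exact intervalIntegral.integral_hasDerivAt_left ((hηc k).intervalIntegrable _ _)
        (hηc k).stronglyMeasurable.stronglyMeasurableAtFilter (hηc k).continuousAt
    have h2 := (hexpd k x).add h1
    rw [← sub_eq_add_neg] at h2
    exact h2
  refine ⟨u, fun k hk => ⟨⟨fun x => (hud k hk x).differentiableAt, fun a b => ?_⟩, R,
    fun x hx => ?_⟩, fun x => ⟨?_, ?_⟩⟩
  · rw [(hud k hk a).deriv, (hud k hk b).deriv]
    have h1 : (∫ t in a..b, -k ^ 2 * Complex.exp (Complex.I * k * t)) =
        Complex.I * k * Complex.exp (Complex.I * k * b) -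
          Complex.I * k * Complex.exp (Complex.I * k * a) := by
      refine intervalIntegral.integral_eq_sub_of_hasDerivAt
        (f := fun t : ℝ => Complex.I * k * Complex.exp (Complex.I * k * t)) (fun t _ => ?_)
        (Continuous.intervalIntegrable
          (by fun_prop : Continuous fun t : ℝ => -k ^ 2 * Complex.exp (Complex.I * k * t)) _ _)
      have e1 : -k ^ 2 * Complex.exp (Complex.I * k * t) =
          Complex.I * k * (Complex.I * k * Complex.exp (Complex.I * k * t)) := by
        linear_combination -k ^ 2 * Complex.exp (Complex.I * k * t) * Complex.I_sq
      rw [e1]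
      exact (hexpd k t).const_mul (Complex.I * k)
    have h2 := intervalIntegral.integral_add_adjacent_intervals (hqint k a b) (hqint k b R)
    rw [← hηint k hk, ← hηint k hk] at h2
    have h3 : (∫ t in a..b, ((q t : ℂ) - k ^ 2) * u k t) =
        (∫ t in a..b, -k ^ 2 * Complex.exp (Complex.I * k * t)) + ∫ t in a..b,
          (((q t : ℂ) - k ^ 2) * χ k t + q t * Complex.exp (Complex.I * k * t)) := by
      rw [← intervalIntegral.integral_add (Continuous.intervalIntegrable
        (by fun_prop : Continuous fun t : ℝ => -k ^ 2 * Complex.exp (Complex.I * k * t)) _ _)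
        (hqint k a b)]
      refine intervalIntegral.integral_congr fun t _ => ?_
      simp only [hu]
      ring
    rw [h3, h1]
    linear_combination -h2
  · simp only [hu]
    rw [hχ0 k hk x hx, add_zero]
  · intro k hk
    have h1 : DifferentiableWithinAt ℂ (fun k => f k x) (Metric.ball 0 M) k :=
      (BoundedContinuousFunction.evalCLM ℂ (β := ℂ) x).differentiableAt.comp_differentiableWithinAt k
        (hfd k hk)
    simp only [hu, hχ]
    exact DifferentiableWithinAt.add (by fun_prop) (h1.const_mul _)
  · have h1 : DifferentiableOn ℂ (fun k => Complex.I * k * Complex.exp (Complex.I * k * x) - η k x)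
        (Metric.ball 0 M) := by
      intro k hk
      have h1 : DifferentiableWithinAt ℂ (fun k => h k x) (Metric.ball 0 M) k :=
        (BoundedContinuousFunction.evalCLM ℂ (β := ℂ) x).differentiableAt.comp_differentiableWithinAt k
          (hhd k hk)
      simp only [hη]
      exact DifferentiableWithinAt.sub (by fun_prop) (h1.const_mul _)
    refine h1.congr fun k hk => ?_
    exact (hud k (by simpa using hk) x).deriv

/-! ### Uniqueness, reflection and the Wronskian -/

theorem IsSchrodingerSolution.intervalIntegrable {q : ℝ → ℝ} {k : ℂ} {f : ℝ → ℂ}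
    (hf : IsSchrodingerSolution q k f) (hq : Integrable q) (a b : ℝ) :
    IntervalIntegrable (fun t => ((q t : ℂ) - k ^ 2) * f t) volume a b :=
  ((hq.ofReal.intervalIntegrable).sub intervalIntegrable_const).mul_continuousOn
    hf.1.continuous.continuousOn

theorem IsSchrodingerSolution.continuous_deriv {q : ℝ → ℝ} {k : ℂ} {f : ℝ → ℂ}
    (hf : IsSchrodingerSolution q k f) (hq : Integrable q) : Continuous (deriv f) := by
  have : deriv f = fun x => deriv f 0 + ∫ t in (0 : ℝ)..x, ((q t : ℂ) - k ^ 2) * f t := by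
    funext x
    rw [← hf.2 0 x]
    ring
  rw [this]
  exact continuous_const.add (intervalIntegral.continuous_primitive (hf.intervalIntegrable hq) 0)

/-- To the right of γ the exponential solves the same equation, so the difference is a solution
there that vanishes eventually. This replaces the unspecified threshold in the definition by γ
itself. -/
theorem IsJostPlus.eq_exp {q : ℝ → ℝ} {k : ℂ} {f : ℝ → ℂ} {γ : ℝ} (hf : IsJostPlus q k f)
    (hq : Integrable q) (hγ : ∀ᵐ t, γ < t → q t = 0) (x : ℝ) (hx : γ ≤ x) :
    f x = Complex.exp (Complex.I * k * x) ∧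
      deriv f x = Complex.I * k * Complex.exp (Complex.I * k * x) := by
  obtain ⟨hs, R, hR⟩ := hf
  have hexp := hasDerivAt_cexp_mul (Complex.I * k)
  have hd : ∀ x, HasDerivAt (fun x : ℝ => f x - Complex.exp (Complex.I * k * x))
      (deriv f x - Complex.I * k * Complex.exp (Complex.I * k * x)) x := fun x =>
    (hs.1 x).hasDerivAt.sub (hexp x)
  have hec : Continuous fun t : ℝ => -k ^ 2 * Complex.exp (Complex.I * k * t) := by fun_prop
  have h := eq_zero_of_eventually_eq_zero (p := fun t => (q t : ℂ) - k ^ 2) (X := γ) (R := R)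
    (d := fun x : ℝ => f x - Complex.exp (Complex.I * k * x))
    (fun a b => (hq.ofReal.intervalIntegrable).sub intervalIntegrable_const)
    (fun x => (hd x).differentiableAt) (fun a b ha hb => by
      have h1 : (∫ t in a..b, -k ^ 2 * Complex.exp (Complex.I * k * t)) =
          Complex.I * k * Complex.exp (Complex.I * k * b) -
            Complex.I * k * Complex.exp (Complex.I * k * a) := by
        refine intervalIntegral.integral_eq_sub_of_hasDerivAt
          (f := fun t : ℝ => Complex.I * k * Complex.exp (Complex.I * k * t)) (fun t _ => ?_)
          (hec.intervalIntegrable _ _)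
        have e1 : -k ^ 2 * Complex.exp (Complex.I * k * t) =
            Complex.I * k * (Complex.I * k * Complex.exp (Complex.I * k * t)) := by
          linear_combination -k ^ 2 * Complex.exp (Complex.I * k * t) * Complex.I_sq
        rw [e1]
        exact (hexp t).const_mul (Complex.I * k)
      have h2 : (∫ t in a..b, ((q t : ℂ) - k ^ 2) * (f t - Complex.exp (Complex.I * k * t))) =
          (∫ t in a..b, ((q t : ℂ) - k ^ 2) * f t) -
            ∫ t in a..b, -k ^ 2 * Complex.exp (Complex.I * k * t) := by
        rw [← intervalIntegral.integral_sub (hs.intervalIntegrable hq a b)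
          (hec.intervalIntegrable _ _)]
        refine intervalIntegral.integral_congr_ae ?_
        filter_upwards [hγ] with t ht htm
        have h3 : γ < t := lt_of_le_of_lt (le_min ha hb) htm.1
        rw [ht h3]
        push_cast
        ring
      rw [(hd a).deriv, (hd b).deriv, h2, h1, ← hs.2 a b]
      ring)
    (fun x hx => by rw [hR x hx, sub_self]) x hx
  rw [(hd x).deriv] at h
  exact ⟨sub_eq_zero.1 h.1, sub_eq_zero.1 h.2⟩

theorem IsJostPlus.unique {q : ℝ → ℝ} {k : ℂ} {f g : ℝ → ℂ} (hq : Integrable q)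
    (hf : IsJostPlus q k f) (hg : IsJostPlus q k g) : f = g := by
  obtain ⟨hs, R, hR⟩ := hf
  obtain ⟨hs', R', hR'⟩ := hg
  have hd : ∀ x, HasDerivAt (fun x => f x - g x) (deriv f x - deriv g x) x := fun x =>
    (hs.1 x).hasDerivAt.sub (hs'.1 x).hasDerivAt
  funext x
  refine sub_eq_zero.1 (eq_zero_of_eventually_eq_zero (p := fun t => (q t : ℂ) - k ^ 2) (X := x)
    (R := max R R') (d := fun x => f x - g x)
    (fun a b => (hq.ofReal.intervalIntegrable).sub intervalIntegrable_const)
    (fun x => (hd x).differentiableAt) (fun a b _ _ => ?_) (fun x hx => ?_) x le_rfl).1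
  · rw [(hd a).deriv, (hd b).deriv, sub_sub_sub_comm, hs.2, hs'.2,
      ← intervalIntegral.integral_sub (hs.intervalIntegrable hq a b)
        (hs'.intervalIntegrable hq a b)]
    simp only [mul_sub]
  · rw [hR x ((le_max_left _ _).trans hx), hR' x ((le_max_right _ _).trans hx), sub_self]

theorem existsUnique_isJostPlus {q : ℝ → ℝ} (hq : Integrable q) {R : ℝ} (hR0 : 0 ≤ R)
    (hR : ∀ᵐ t, R < |t| → q t = 0) (k : ℂ) : ∃! f, IsJostPlus q k f := by
  obtain ⟨u, hu, -⟩ := exists_jost_family hq hR0 hR (‖k‖ + 1)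
  exact ⟨u k, hu k (lt_add_one _), fun g hg => hg.unique hq (hu k (lt_add_one _))⟩

theorem isJostPlus_jostPlus {q : ℝ → ℝ} (hq : Integrable q) {R : ℝ} (hR0 : 0 ≤ R)
    (hR : ∀ᵐ t, R < |t| → q t = 0) (k : ℂ) : IsJostPlus q k (jostPlus q k) :=
  Classical.epsilon_spec (existsUnique_isJostPlus hq hR0 hR k).exists

/-- The choice made by `Classical.epsilon` is separate for each k; uniqueness identifies it with the
analytic family on a disc around k. -/
theorem differentiable_jostPlus {q : ℝ → ℝ} (hq : Integrable q) {R : ℝ} (hR0 : 0 ≤ R)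
    (hR : ∀ᵐ t, R < |t| → q t = 0) (x : ℝ) :
    Differentiable ℂ (fun k => jostPlus q k x) ∧
      Differentiable ℂ (fun k => deriv (jostPlus q k) x) := by
  have key : ∀ k : ℂ, DifferentiableAt ℂ (fun k => jostPlus q k x) k ∧
      DifferentiableAt ℂ (fun k => deriv (jostPlus q k) x) k := by
    intro k
    obtain ⟨u, hu, hd⟩ := exists_jost_family hq hR0 hR (‖k‖ + 1)
    have hmem : Metric.ball (0 : ℂ) (‖k‖ + 1) ∈ 𝓝 k :=
      Metric.isOpen_ball.mem_nhds (by simp)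
    have heq : ∀ z ∈ Metric.ball (0 : ℂ) (‖k‖ + 1), jostPlus q z = u z := fun z hz =>
      (isJostPlus_jostPlus hq hR0 hR z).unique hq (hu z (by simpa using hz))
    exact ⟨(((hd x).1).congr fun z hz => by rw [heq z hz]).differentiableAt hmem,
      (((hd x).2).congr fun z hz => by rw [heq z hz]).differentiableAt hmem⟩
  exact ⟨fun k => (key k).1, fun k => (key k).2⟩

/-- The substitution x ↦ -x transfers the theory of ψ₊ to ψ₋. -/
theorem IsJostMinus.reflect {q : ℝ → ℝ} {k : ℂ} {f : ℝ → ℂ} (hf : IsJostMinus q k f) :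
    IsJostPlus (fun x => q (-x)) k (fun x => f (-x)) := by
  obtain ⟨⟨h1, h2⟩, R, hR⟩ := hf
  refine ⟨⟨h1.comp differentiable_neg, fun a b => ?_⟩, -R, fun x hx => ?_⟩
  · rw [deriv_comp_neg, deriv_comp_neg,
      intervalIntegral.integral_comp_neg (fun x => ((q x : ℂ) - k ^ 2) * f x), ← h2]
    ring
  · change f (-x) = _
    rw [hR (-x) (by linarith)]
    push_cast
    ring_nf

theorem IsJostPlus.reflect {q : ℝ → ℝ} {k : ℂ} {f : ℝ → ℂ}
    (hf : IsJostPlus (fun x => q (-x)) k f) : IsJostMinus q k (fun x => f (-x)) := by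
  obtain ⟨⟨h1, h2⟩, R, hR⟩ := hf
  refine ⟨⟨h1.comp differentiable_neg, fun a b => ?_⟩, -R, fun x hx => ?_⟩
  · have h3 := h2 (-a) (-b)
    have h4 := intervalIntegral.integral_comp_neg (a := a) (b := b)
      (fun x => ((q (-x) : ℂ) - k ^ 2) * f x)
    simp only [neg_neg] at h4
    rw [deriv_comp_neg, deriv_comp_neg, h4, intervalIntegral.integral_symm, ← h3]
    ring
  · change f (-x) = _
    rw [hR (-x) (by linarith)]
    push_cast
    ring_nf

theorem existsUnique_isJostMinus {q : ℝ → ℝ} (hq : Integrable q) {R : ℝ} (hR0 : 0 ≤ R)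
    (hR : ∀ᵐ t, R < |t| → q t = 0) (k : ℂ) : ∃! f, IsJostMinus q k f := by
  have hR' : ∀ᵐ t, R < |t| → q (-t) = 0 := by
    have := (Measure.measurePreserving_neg (volume : Measure ℝ)).quasiMeasurePreserving.ae hR
    simpa only [abs_neg] using this
  obtain ⟨f, hf, -⟩ := existsUnique_isJostPlus hq.comp_neg hR0 hR' k
  refine ⟨_, hf.reflect, fun g hg => ?_⟩
  have := hg.reflect.unique hq.comp_neg hf
  funext x
  rw [← this]
  simp

/-- The potential vanishes on the negative axis, so ψ₋ is exactly e^{-ikx} up to 0, with value 1 and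
derivative -ik there. -/
theorem jostWronskian_eq {q : ℝ → ℝ} (hq : Integrable q) {R : ℝ} (hR0 : 0 ≤ R)
    (hR : ∀ᵐ t, R < |t| → q t = 0) (h0 : ∀ᵐ t, t < 0 → q t = 0) (k : ℂ) :
    jostWronskian q k = deriv (jostPlus q k) 0 + Complex.I * k * jostPlus q k 0 := by
  have hm : IsJostMinus q k (jostMinus q k) :=
    Classical.epsilon_spec (existsUnique_isJostMinus hq hR0 hR k).exists
  have h0' : ∀ᵐ t, 0 < t → q (-t) = 0 := by
    have := (Measure.measurePreserving_neg (volume : Measure ℝ)).quasiMeasurePreserving.ae h0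
    simpa only [Left.neg_neg_iff] using this
  obtain ⟨e1, e2⟩ := hm.reflect.eq_exp hq.comp_neg h0' 0 le_rfl
  rw [deriv_comp_neg] at e2
  simp only [neg_zero, Complex.ofReal_zero, mul_zero, Complex.exp_zero, mul_one] at e1 e2
  have e3 : deriv (jostMinus q k) 0 = -(Complex.I * k) := by linear_combination -e2
  rw [jostWronskian, e1, e3]
  ring

/-! ### Bounds and Wronskian identity for the Jost solution -/

/-- The exponential-type bound for the Jost solution at the origin. -/
theorem IsJostPlus.norm_le {q : ℝ → ℝ} {k : ℂ} {f : ℝ → ℂ} {γ : ℝ} (hf : IsJostPlus q k f)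
    (hq : Integrable q) (hγ0 : 0 ≤ γ) (hγ : ∀ᵐ t, γ < t → q t = 0) (hk : k ≠ 0) :
    (‖deriv f 0 + Complex.I * k * f 0‖ + ‖deriv f 0 - Complex.I * k * f 0‖) / 2 ≤
      ‖k‖ * Real.exp (2 * |k.im| * γ + (∫ t, |q t|) / ‖k‖) := by
  have hk0 : 0 < ‖k‖ := norm_pos_iff.2 hk
  have hs := hf.1
  have hfc := hs.1.continuous
  have hfc' := hs.continuous_deriv hq
  obtain ⟨e1, e2⟩ := hf.eq_exp hq hγ γ le_rfl
  -- variation of constants for the two first-order factors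
  have var : ∀ (c : ℂ), c ^ 2 = -k ^ 2 → ∀ x : ℝ, Complex.exp (-c * γ) * (deriv f γ + c * f γ) -
      Complex.exp (-c * x) * (deriv f x + c * f x) =
        ∫ t in x..γ, Complex.exp (-c * t) * (q t * f t) := by
    intro c hc x
    rw [integral_product_rule (e := fun t : ℝ => Complex.exp (-c * t))
      (e' := fun t : ℝ => -c * Complex.exp (-c * t)) (h := fun t => deriv f t + c * f t)
      (g := fun t => ((q t : ℂ) - k ^ 2) * f t + c * deriv f t) (hasDerivAt_cexp_mul (-c))
      (by fun_prop)
      (fun a b => (hs.intervalIntegrable hq a b).add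
        ((hfc'.const_mul c : Continuous fun t => c * deriv f t).intervalIntegrable a b))
      (fun a b => by
        rw [intervalIntegral.integral_add (hs.intervalIntegrable hq a b)
          ((hfc'.const_mul c : Continuous fun t => c * deriv f t).intervalIntegrable a b),
          ← hs.2, intervalIntegral.integral_const_mul,
          intervalIntegral.integral_deriv_eq_sub (fun t _ => hs.1 t)
          (hfc'.intervalIntegrable a b)]
        ring) x γ]
    refine intervalIntegral.integral_congr fun t _ => ?_
    linear_combination -Complex.exp (-c * t) * f t * hc
  -- For t ≥ x the kernel e^{c(x-t)} grows at most like e^{|Im k|(t-x)}. The weight e^{|Im k| x}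
  -- turns this into e^{|Im k| t}, so both factors satisfy the same Gronwall-ready inequality.
  have bound : ∀ (c : ℂ), c ^ 2 = -k ^ 2 → (∀ t, |c.re * t| ≤ |k.im| * |t|) → ∀ x ∈ Set.Icc 0 γ,
      Real.exp (|k.im| * x) * ‖deriv f x + c * f x‖ ≤
        Real.exp (2 * |k.im| * γ) * ‖Complex.exp (-c * γ) * (deriv f γ + c * f γ)‖ +
        ∫ t in x..γ, Real.exp (|k.im| * t) * (|q t| * ‖f t‖) := by
    intro c hc hcre x hx
    have h1 : deriv f x + c * f x = Complex.exp (c * x) * (Complex.exp (-c * γ) *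
        (deriv f γ + c * f γ)) - ∫ t in x..γ, Complex.exp (c * (x - t)) * (q t * f t) := by
      have h2 : (∫ t in x..γ, Complex.exp (c * (x - t)) * (q t * f t)) =
          Complex.exp (c * x) * ∫ t in x..γ, Complex.exp (-c * t) * (q t * f t) := by
        rw [← intervalIntegral.integral_const_mul]
        refine intervalIntegral.integral_congr fun t _ => ?_
        rw [mul_sub, sub_eq_add_neg, Complex.exp_add, neg_mul]
        ring
      rw [h2, ← var c hc x, mul_sub, sub_sub_cancel, ← mul_assoc, ← Complex.exp_add]
      simp
    have hint : IntervalIntegrable (fun t => Real.exp (|k.im| * t) * (|q t| * ‖f t‖))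
        volume x γ :=
      ((hq.abs.intervalIntegrable).mul_continuousOn hfc.norm.continuousOn).continuousOn_mul
        (by fun_prop)
    have hre : ∀ t, c.re * t ≤ |k.im| * |t| := fun t => (le_abs_self _).trans (hcre t)
    calc Real.exp (|k.im| * x) * ‖deriv f x + c * f x‖
        ≤ Real.exp (|k.im| * x) * (‖Complex.exp (c * x) * (Complex.exp (-c * γ) *
          (deriv f γ + c * f γ))‖ +
            ‖∫ t in x..γ, Complex.exp (c * (x - t)) * (q t * f t)‖) := by
          rw [h1]
          exact mul_le_mul_of_nonneg_left (norm_sub_le _ _) (Real.exp_pos _).le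
      _ ≤ _ := by
          rw [mul_add]
          refine add_le_add ?_ ?_
          · rw [norm_mul, ← mul_assoc, Complex.norm_exp, ← Real.exp_add]
            refine mul_le_mul_of_nonneg_right (Real.exp_le_exp.2 ?_) (norm_nonneg _)
            have h3 := hre x
            rw [abs_of_nonneg hx.1] at h3
            have h4 : |k.im| * x ≤ |k.im| * γ := mul_le_mul_of_nonneg_left hx.2 (abs_nonneg _)
            simp only [Complex.mul_re, Complex.ofReal_re, Complex.ofReal_im, mul_zero, sub_zero]
            linarith
          · rw [← abs_of_pos (Real.exp_pos (|k.im| * x)), ← Real.norm_eq_abs,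
              ← Complex.norm_real, ← norm_mul, ← intervalIntegral.integral_const_mul]
            refine intervalIntegral.norm_integral_le_of_norm_le hx.2
              (ae_of_all _ fun t ht => ?_) hint
            have h3 := hre (x - t)
            rw [abs_of_nonpos (show x - t ≤ 0 by linarith [ht.1])] at h3
            rw [norm_mul, norm_mul, norm_mul, Complex.norm_real, Complex.norm_real,
              Complex.norm_exp, Real.norm_of_nonneg (Real.exp_pos _).le, ← mul_assoc,
              ← Real.exp_add, Real.norm_eq_abs]
            refine mul_le_mul_of_nonneg_right (Real.exp_le_exp.2 ?_) (by positivity)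
            have h4 : (c * ((x : ℂ) - t)).re = c.re * (x - t) := by simp
            rw [h4]
            linarith
  have hIk : (Complex.I * k) ^ 2 = -k ^ 2 := by rw [mul_pow, Complex.I_sq]; ring
  have hre : ∀ t : ℝ, |(Complex.I * k).re * t| ≤ |k.im| * |t| := fun t => by
    simp [abs_mul]
  have hre' : ∀ t : ℝ, |(-(Complex.I * k)).re * t| ≤ |k.im| * |t| := fun t => by
    simp [abs_mul]
  have b1 := bound (Complex.I * k) hIk hre
  have b2 := bound (-(Complex.I * k)) (by rw [neg_sq, hIk]) hre'
  -- At γ the solution is a pure exponential: one first-order factor contributes 2ik, the other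
  -- vanishes.
  have n1 : ‖Complex.exp (-(Complex.I * k) * γ) * (deriv f γ + Complex.I * k * f γ)‖ =
      2 * ‖k‖ := by
    have : Complex.exp (-(Complex.I * k) * γ) * (deriv f γ + Complex.I * k * f γ) =
        2 * (Complex.I * k) := by
      have h3 : Complex.exp (-(Complex.I * k) * γ) * Complex.exp (Complex.I * k * γ) = 1 := by
        rw [← Complex.exp_add]; simp
      rw [e1, e2]
      linear_combination 2 * (Complex.I * k) * h3
    rw [this]
    simp
  have n2 : ‖Complex.exp (-(-(Complex.I * k)) * γ) * (deriv f γ + -(Complex.I * k) * f γ)‖ = 0 := by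
    rw [e1, e2]
    simp
  set g : ℝ → ℝ := fun x => Real.exp (|k.im| * x) *
    ((‖deriv f x + Complex.I * k * f x‖ + ‖deriv f x + -(Complex.I * k) * f x‖) / 2) with hg
  have hgc : Continuous g := by
    simp only [hg]
    fun_prop
  -- The difference of the two factors is 2ikf; dividing by |k| here is the source of ‖q‖/|k| in the
  -- exponent.
  have hfg : ∀ t, Real.exp (|k.im| * t) * ‖f t‖ ≤ g t / ‖k‖ := by
    intro t
    simp only [hg]
    rw [le_div_iff₀ hk0, mul_assoc]
    refine mul_le_mul_of_nonneg_left ?_ (Real.exp_pos _).le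
    have h3 : 2 * (Complex.I * k) * f t = (deriv f t + Complex.I * k * f t) -
        (deriv f t + -(Complex.I * k) * f t) := by ring
    have h4 := norm_sub_le (deriv f t + Complex.I * k * f t) (deriv f t + -(Complex.I * k) * f t)
    rw [← h3] at h4
    simp only [norm_mul, Complex.norm_ofNat, Complex.norm_I, one_mul] at h4
    linarith
  have hαi : ∀ a b, IntervalIntegrable (fun t => |q t| / ‖k‖) volume a b := fun a b =>
    (hq.abs.div_const _).intervalIntegrable
  have main := gronwall_integral (g := g) (α := fun t => |q t| / ‖k‖)
    (c := ‖k‖ * Real.exp (2 * |k.im| * γ)) hγ0 (hαi 0 γ) (fun t => by positivity)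
    (fun t => by positivity) ((hαi 0 γ).mul_continuousOn hgc.continuousOn) (fun x hx => by
      have h1 := b1 x hx
      have h2 := b2 x hx
      rw [n1] at h1
      rw [n2] at h2
      have h3 : (∫ t in x..γ, Real.exp (|k.im| * t) * (|q t| * ‖f t‖)) ≤
          ∫ t in x..γ, |q t| / ‖k‖ * g t := by
        refine intervalIntegral.integral_mono_on hx.2
          (((hq.abs.intervalIntegrable).mul_continuousOn hfc.norm.continuousOn).continuousOn_mul
            (by fun_prop)) ((hαi x γ).mul_continuousOn hgc.continuousOn) fun t _ => ?_
        have := mul_le_mul_of_nonneg_left (hfg t) (abs_nonneg (q t))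
        calc _ = |q t| * (Real.exp (|k.im| * t) * ‖f t‖) := by ring
          _ ≤ _ := this
          _ = _ := by ring
      have h4 : g x = (Real.exp (|k.im| * x) * ‖deriv f x + Complex.I * k * f x‖ +
        Real.exp (|k.im| * x) * ‖deriv f x + -(Complex.I * k) * f x‖) / 2 := by
        simp only [hg]; ring
      rw [h4]
      linarith)
  have hN : (∫ t in (0 : ℝ)..γ, |q t| / ‖k‖) ≤ (∫ t, |q t|) / ‖k‖ := by
    rw [intervalIntegral.integral_div, intervalIntegral.integral_of_le hγ0]
    exact div_le_div_of_nonneg_right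
      (setIntegral_le_integral hq.abs (ae_of_all _ fun t => abs_nonneg _)) hk0.le
  simp only [hg, mul_zero, Real.exp_zero, one_mul, neg_mul, ← sub_eq_add_neg] at main
  refine main.trans ?_
  rw [mul_assoc, ← Real.exp_add]
  exact mul_le_mul_of_nonneg_left (Real.exp_le_exp.2 (by linarith)) hk0.le

/-- The Wronskian of `ψ₊(·, k)` and its conjugate, for real `k`. -/
theorem IsJostPlus.im_deriv_mul_conj {q : ℝ → ℝ} {k : ℝ} {f : ℝ → ℂ} (hf : IsJostPlus q k f)
    (hq : Integrable q) (x : ℝ) :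
    (deriv f x * starRingEnd ℂ (f x)).im = k := by
  obtain ⟨hs, R, hR⟩ := hf
  have hd : ∀ x, HasDerivAt (fun x => starRingEnd ℂ (f x)) (starRingEnd ℂ (deriv f x)) x :=
    fun x => (hs.1 x).hasDerivAt.star
  have hfc' := hs.continuous_deriv hq
  set y := max x (R + 1) with hy
  have h1 := integral_product_rule hd (by fun_prop : Continuous fun x => starRingEnd ℂ (deriv f x))
    (hs.intervalIntegrable hq) hs.2 x y
  have hy' : R < y := by linarith [le_max_right x (R + 1)]
  have ey : deriv f y = Complex.I * k * Complex.exp (Complex.I * k * y) := by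
    have : f =ᶠ[𝓝 y] fun y : ℝ => Complex.exp (Complex.I * k * y) := by
      filter_upwards [lt_mem_nhds hy'] with z hz using hR z hz.le
    rw [this.deriv_eq, (hasDerivAt_cexp_mul (Complex.I * k) y).deriv]
  -- The derivative of conj(f) f' is |f'|² + (q - k²)|f|², which is real because q and k are. Hence
  -- the imaginary part is constant and can be read off where f is an exponential.
  have hre : (∫ t in x..y, (starRingEnd ℂ (deriv f t) * deriv f t +
      starRingEnd ℂ (f t) * (((q t : ℂ) - (k : ℂ) ^ 2) * f t))) =
      ((∫ t in x..y, (Complex.normSq (deriv f t) + (q t - k ^ 2) * Complex.normSq (f t)) : ℝ)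
        : ℂ) := by
    rw [← intervalIntegral.integral_ofReal]
    refine intervalIntegral.integral_congr fun t _ => ?_
    push_cast
    rw [Complex.normSq_eq_conj_mul_self, Complex.normSq_eq_conj_mul_self]
    ring
  rw [hre] at h1
  have h2 := congrArg Complex.im h1
  rw [Complex.ofReal_im, Complex.sub_im, sub_eq_zero] at h2
  rw [mul_comm, ← h2, ey, hR y hy'.le, mul_left_comm, mul_comm, mul_comm (starRingEnd ℂ _),
    Complex.mul_conj, Complex.normSq_eq_norm_sq, Complex.norm_exp]
  simp

/-! ### Jensen's inequality and sums over zeros -/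

/-- Jensen's inequality for F/F(c) on concentric discs of radii ρ and 2ρ; the ratio of the radii
gives the log 2. -/
theorem sum_analyticOrderAt_le {F : ℂ → ℂ} (hF : Differentiable ℂ F) {c : ℂ} {ρ B : ℝ}
    (hc : F c ≠ 0) (hρ : 0 < ρ) (hB0 : 0 ≤ B)
    (hB : ∀ z, ‖z - c‖ = 2 * ρ → ‖F z‖ ≤ ‖F c‖ * Real.exp B) (T : Finset ℂ)
    (hT : ∀ z ∈ T, ‖z - c‖ ≤ ρ) :
    ∑ z ∈ T, (analyticOrderAt F z : ℝ≥0∞) ≤ ENNReal.ofReal (B / Real.log 2) := by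
  have hFa : ∀ z, AnalyticAt ℂ F z := fun z => hF.analyticAt z
  set G : ℂ → ℂ := fun z => (F c)⁻¹ * F z with hG
  have hGa : ∀ z, AnalyticAt ℂ G z := fun z => analyticAt_const.mul (hFa z)
  have hord : ∀ z, analyticOrderAt G z = analyticOrderAt F z := by
    intro z
    have h1 : G = (fun _ => (F c)⁻¹) * F := rfl
    rw [h1, analyticOrderAt_mul analyticAt_const (hFa z),
      analyticAt_const.analyticOrderAt_eq_zero.2 (inv_ne_zero hc), zero_add]
  have hGc : G c = 1 := inv_mul_cancel₀ hc
  have htop : ∀ z, analyticOrderAt G z ≠ ⊤ := by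
    intro z hz
    have h0 : G = 0 := AnalyticOnNhd.eq_of_eventuallyEq (fun z _ => hGa z)
      (fun z _ => analyticAt_const) (analyticOrderAt_eq_top.1 hz)
    rw [h0] at hGc
    exact zero_ne_one hGc
  have hGn : AnalyticOnNhd ℂ G (Metric.closedBall c |ρ|) := fun z _ => hGa z
  have jensen := AnalyticOnNhd.sum_divisor_le (c := c) (r := ρ) (R := 2 * ρ) (M := Real.exp B)
    (f := G) (by positivity) (by rw [abs_of_pos hρ, abs_of_pos (by positivity)]; linarith)
    (Real.one_le_exp hB0) (fun z _ => hGa z) (by rw [hGc]; exact one_ne_zero) (fun z hz => by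
      rw [mem_sphere_iff_norm, abs_of_pos (by positivity)] at hz
      simp only [hG, norm_mul, norm_inv]
      rw [inv_mul_le_iff₀ (norm_pos_iff.2 hc)]
      exact hB z hz)
  rw [hGc, norm_one, div_one, Real.log_exp, mul_div_assoc, div_self hρ.ne', mul_one] at jensen
  set D := MeromorphicOn.divisor G (Metric.closedBall c |ρ|) with hD
  have hDn : ∀ z ∈ T, (D z : ℝ) = ((analyticOrderAt F z).toNat : ℝ) := by
    intro z hz
    have hz' : z ∈ Metric.closedBall c |ρ| := by
      rw [mem_closedBall_iff_norm, abs_of_pos hρ]; exact hT z hz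
    rw [hD, MeromorphicOn.AnalyticOnNhd.divisor_apply hGn hz', ← hord z]
    obtain ⟨n, hn⟩ := ENat.ne_top_iff_exists.1 (htop z)
    rw [← hn]
    simp
  have hD0 : 0 ≤ D := MeromorphicOn.AnalyticOnNhd.divisor_nonneg hGn
  have hfin : (D.support).Finite := D.finiteSupport (isCompact_closedBall _ _)
  have hsum : ∑ z ∈ T, D z ≤ ∑ᶠ z, D z := by
    classical
    rw [finsum_eq_sum_of_support_subset (s := hfin.toFinset ∪ T) D (by
      intro z hz
      simp only [Finset.coe_union, Set.Finite.coe_toFinset]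
      exact Or.inl hz)]
    exact Finset.sum_le_sum_of_subset_of_nonneg Finset.subset_union_right fun z _ _ => hD0 z
  have hreal : ∑ z ∈ T, ((analyticOrderAt F z).toNat : ℝ) ≤ B / Real.log 2 := by
    rw [← Finset.sum_congr rfl hDn]
    refine le_trans ?_ jensen
    exact_mod_cast hsum
  calc ∑ z ∈ T, (analyticOrderAt F z : ℝ≥0∞)
      = ∑ z ∈ T, ENNReal.ofReal ((analyticOrderAt F z).toNat : ℝ) := by
        refine Finset.sum_congr rfl fun z _ => ?_
        rw [← hord z]
        obtain ⟨n, hn⟩ := ENat.ne_top_iff_exists.1 (htop z)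
        rw [← hn]
        simp
    _ = ENNReal.ofReal (∑ z ∈ T, ((analyticOrderAt F z).toNat : ℝ)) :=
        (ENNReal.ofReal_sum_of_nonneg fun _ _ => Nat.cast_nonneg _).symm
    _ ≤ _ := ENNReal.ofReal_le_ofReal hreal

theorem lintegral_rpow_Ioi {a p : ℝ} (ha : 0 < a) (hp : 0 < p) {b : ℝ} (hb : 0 ≤ b) :
    ∫⁻ s in Set.Ioi a, ENNReal.ofReal (b * s ^ (-p - 1)) = ENNReal.ofReal (b * (a ^ (-p) / p)) := by
  rw [← ofReal_integral_eq_lintegral_ofReal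
    ((integrableOn_Ioi_rpow_of_lt (by linarith) ha).const_mul b)
    ((ae_restrict_iff' measurableSet_Ioi).2 (ae_of_all _ fun s hs =>
      mul_nonneg hb (Real.rpow_nonneg (ha.trans hs).le _))),
    integral_const_mul, integral_Ioi_rpow_of_lt (by linarith) ha]
  congr 2
  rw [sub_add_cancel, neg_div_neg_eq]

/-- Summation by parts: a linear bound for a counting function bounds the sum of powers. -/
theorem sum_mul_rpow_le {ι : Type*} (T : Finset ι) (m : ι → ℝ≥0∞) (d : ι → ℝ) {a A p : ℝ}
    (ha : 0 < a) (hd : ∀ i ∈ T, a ≤ d i) (hA : 0 ≤ A) (hp : 1 < p)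
    (h : ∀ s, a < s → ∑ i ∈ T with d i < s, m i ≤ ENNReal.ofReal (A * s)) :
    ∑ i ∈ T, m i * ENNReal.ofReal (d i ^ (-p)) ≤
      ENNReal.ofReal (A * p * (a ^ (1 - p) / (p - 1))) := by
  have hp0 : 0 < p := by linarith
  set g : ℝ → ℝ≥0∞ := fun s => ENNReal.ofReal (p * s ^ (-p - 1)) with hg
  have hgm : Measurable g := by
    simp only [hg]
    fun_prop
  -- Layer-cake form: d^{-p} is the integral of p s^{-p-1} over s > d, so exchanging sum and
  -- integral brings out the counting function.
  have e1 : ∀ i ∈ T, ENNReal.ofReal (d i ^ (-p)) =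
      ∫⁻ s in Set.Ioi a, (Set.Ioi (d i)).indicator g s := by
    intro i hi
    rw [lintegral_indicator measurableSet_Ioi, Measure.restrict_restrict measurableSet_Ioi,
      Set.inter_eq_left.2 (Set.Ioi_subset_Ioi (hd i hi)),
      lintegral_rpow_Ioi (ha.trans_le (hd i hi)) hp0 hp0.le]
    congr 1
    field_simp
  calc ∑ i ∈ T, m i * ENNReal.ofReal (d i ^ (-p))
      = ∑ i ∈ T, ∫⁻ s in Set.Ioi a, m i * (Set.Ioi (d i)).indicator g s := by
        refine Finset.sum_congr rfl fun i hi => ?_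
        rw [e1 i hi, lintegral_const_mul _ (hgm.indicator measurableSet_Ioi)]
    _ = ∫⁻ s in Set.Ioi a, ∑ i ∈ T, m i * (Set.Ioi (d i)).indicator g s :=
        (lintegral_finsetSum _ fun i _ => (hgm.indicator measurableSet_Ioi).const_mul _).symm
    _ ≤ ∫⁻ s in Set.Ioi a, ENNReal.ofReal (A * p * s ^ (-(p - 1) - 1)) := by
        refine setLIntegral_mono (by fun_prop) fun s hs => ?_
        have hs0 : 0 < s := ha.trans hs
        calc ∑ i ∈ T, m i * (Set.Ioi (d i)).indicator g s
            = (∑ i ∈ T with d i < s, m i) * g s := by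
              rw [Finset.sum_mul, Finset.sum_filter]
              refine Finset.sum_congr rfl fun i _ => ?_
              simp only [Set.indicator_apply, Set.mem_Ioi, mul_ite, mul_zero]
          _ ≤ ENNReal.ofReal (A * s) * g s := mul_le_mul_left (h s hs) _
          _ = _ := by
              rw [hg, ← ENNReal.ofReal_mul (by positivity)]
              congr 1
              rw [show -(p - 1) - 1 = (-p - 1) + 1 by ring, Real.rpow_add_one hs0.ne']
              ring
    _ = _ := by
        rw [lintegral_rpow_Ioi ha (by linarith) (by positivity)]
        congr 4
        ring

/-! ### Comparison with the Gamma ratio -/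

/-- Log-convexity at the midpoint x + 1 of x + 1/2 and x + 3/2 gives xΓ(x) ≤ √(x + 1/2) Γ(x + 1/2),
and √(x + 1/2) ≤ 2x for x ≥ 1/2, with equality at 1/2. -/
theorem Gamma_le_two_mul_Gamma_add_half {x : ℝ} (hx : 1 / 2 ≤ x) :
    Real.Gamma x ≤ 2 * Real.Gamma (x + 1 / 2) := by
  have hx0 : 0 < x := by linarith
  have hG := Real.Gamma_pos_of_pos hx0
  have hG' := Real.Gamma_pos_of_pos (show 0 < x + 1 / 2 by linarith)
  have h1 := Real.Gamma_mul_add_mul_le_rpow_Gamma_mul_rpow_Gamma (s := x + 1 / 2)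
    (t := x + 1 / 2 + 1) (a := 1 / 2) (b := 1 / 2) (by linarith) (by linarith) (by norm_num)
    (by norm_num) (by norm_num)
  rw [show 1 / 2 * (x + 1 / 2) + 1 / 2 * (x + 1 / 2 + 1) = x + 1 by ring,
    Real.Gamma_add_one hx0.ne', Real.Gamma_add_one (by linarith),
    ← Real.mul_rpow hG'.le (by positivity),
    show Real.Gamma (x + 1 / 2) * ((x + 1 / 2) * Real.Gamma (x + 1 / 2)) =
      (x + 1 / 2) * Real.Gamma (x + 1 / 2) ^ 2 by ring, ← Real.sqrt_eq_rpow,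
    Real.sqrt_mul (by linarith), Real.sqrt_sq hG'.le] at h1
  have h2 : √(x + 1 / 2) ≤ 2 * x := Real.sqrt_le_iff.2 ⟨by linarith, by nlinarith⟩
  have h3 : x * Real.Gamma x ≤ x * (2 * Real.Gamma (x + 1 / 2)) := by nlinarith
  exact le_of_mul_le_mul_left h3 hx0

/-- The preceding inequality at x = p/2 gives Y_p ≥ √π/(p - 1), which has the same pole at p = 1 as
the left side. It remains that 21p ≤ 32 · 2^{p-1}, which follows from 2^{p-1} ≥ 1 + (p - 1) log 2
since 32 log 2 > 21. -/
theorem mul_rpow_div_le_Gamma_ratio {p : ℝ} (hp : 1 < p) :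
    21 * (p * (2 ^ (1 - p) / (p - 1))) ≤
      32 * (√Real.pi * Real.Gamma ((p - 1) / 2) / Real.Gamma (p / 2)) := by
  have hp0 : 0 < p - 1 := by linarith
  have hG := Real.Gamma_pos_of_pos (show 0 < p / 2 by linarith)
  have h1 : Real.Gamma (p / 2) ≤ (p - 1) * Real.Gamma ((p - 1) / 2) := by
    have := Gamma_le_two_mul_Gamma_add_half (show 1 / 2 ≤ p / 2 by linarith)
    rw [show p / 2 + 1 / 2 = (p - 1) / 2 + 1 by ring,
      Real.Gamma_add_one (by positivity)] at this
    linarith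
  have hpi : 1 ≤ √Real.pi := Real.one_le_sqrt.2 (by linarith [Real.pi_gt_three])
  have h2 : p * 2 ^ (1 - p) * 21 ≤ 32 := by
    have h3 : 1 + (p - 1) * Real.log 2 ≤ (2 : ℝ) ^ (p - 1) := by
      rw [Real.rpow_def_of_pos two_pos, mul_comm (Real.log 2)]
      linarith [Real.add_one_le_exp ((p - 1) * Real.log 2)]
    have h4 : (2 : ℝ) ^ (1 - p) = ((2 : ℝ) ^ (p - 1))⁻¹ := by
      rw [← Real.rpow_neg two_pos.le]; ring_nf
    rw [h4, ← div_eq_mul_inv, div_mul_eq_mul_div, div_le_iff₀ (by positivity)]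
    nlinarith [Real.log_two_gt_d9]
  rw [← mul_div_assoc, ← mul_div_assoc, ← mul_div_assoc, div_le_div_iff₀ hp0 hG]
  have hG1 : 0 < Real.Gamma ((p - 1) / 2) := Real.Gamma_pos_of_pos (by positivity)
  calc 21 * (p * 2 ^ (1 - p)) * Real.Gamma (p / 2) ≤ 32 * Real.Gamma (p / 2) :=
        mul_le_mul_of_nonneg_right (by linarith) hG.le
    _ ≤ 32 * ((p - 1) * Real.Gamma ((p - 1) / 2)) := by linarith
    _ ≤ 32 * (√Real.pi * ((p - 1) * Real.Gamma ((p - 1) / 2))) := by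
        have := le_mul_of_one_le_left (mul_pos hp0 hG1).le hpi
        linarith
    _ = _ := by ring

/-! ### From growth to the zero sums -/

theorem tsum_zeros_le {F : ℂ → ℂ} (hF : Differentiable ℂ F) {γ Q : ℝ} (hγ : 0 ≤ γ) (hQ : 0 ≤ Q)
    (h1 : F 1 ≠ 0)
    (h : ∀ z, 2 ≤ ‖z - 1‖ → ‖F z‖ ≤ ‖F 1‖ * Real.exp (‖z - 1‖ * (1 + 2 * γ) + Q))
    (S : Set ℂ) (w : ℂ) (hw : ∀ z ∈ S, 2 ≤ ‖z - w‖) (hw1 : ∀ z ∈ S, ‖z - 1‖ ≤ 9 / 8 * ‖z - w‖)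
    {p : ℝ} (hp : 1 < p) :
    ∑' k : S, (analyticOrderAt F (k : ℂ) : ℝ≥0∞) * ENNReal.ofReal (‖(k : ℂ) - w‖ ^ (-p)) ≤
      ENNReal.ofReal (32 * (√Real.pi * Real.Gamma ((p - 1) / 2) / Real.Gamma (p / 2)) *
        (1 + γ / Real.pi + Q)) := by
  -- Jensen on radii 9s/8 and 9s/4 gives at most (9s(1 + 2γ)/4 + Q)/log 2 zeros. The γ-term is
  -- decisive: 9π/(2 log 2) < 21. The term Q is absorbed through s > 2.
  set A : ℝ := 21 * (1 + γ / Real.pi + Q) with hA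
  have hA0 : 0 ≤ A := by positivity
  rw [ENNReal.tsum_eq_iSup_sum]
  refine iSup_le fun T => ?_
  refine (sum_mul_rpow_le T _ (fun k => ‖(k : ℂ) - w‖) two_pos (fun k _ => hw k k.2) hA0 hp
    fun s hs => ?_).trans (ENNReal.ofReal_le_ofReal ?_)
  · set B : ℝ := 9 / 4 * s * (1 + 2 * γ) + Q with hB
    have hB0 : 0 ≤ B := by positivity
    have := sum_analyticOrderAt_le hF h1 (ρ := 9 / 8 * s) (B := B) (by linarith) hB0
      (fun z hz => by
        have h2 := h z (by rw [hz]; linarith)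
        rw [hz, show 2 * (9 / 8 * s) = 9 / 4 * s by ring] at h2
        exact h2) ((T.filter fun k : S => ‖(k : ℂ) - w‖ < s).map (Function.Embedding.subtype _))
      (fun z hz => by
        obtain ⟨k, hk, rfl⟩ := Finset.mem_map.1 hz
        have h3 := (Finset.mem_filter.1 hk).2
        have h4 := hw1 k k.2
        simp only [Function.Embedding.subtype_apply]
        linarith)
    rw [Finset.sum_map] at this
    refine this.trans (ENNReal.ofReal_le_ofReal ?_)
    have hl := Real.log_two_gt_d9
    rw [div_le_iff₀ (by linarith), hB, hA]
    have hg : γ = Real.pi * (γ / Real.pi) := by field_simp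
    have hg0 : 0 ≤ γ / Real.pi := by positivity
    set g := γ / Real.pi
    have e1 : γ ≤ 3.15 * g := by
      rw [hg]
      exact mul_le_mul_of_nonneg_right Real.pi_lt_d2.le hg0
    have e2 : 9 / 4 * (1 + 2 * γ) + Q / 2 ≤ 21 * (1 + g + Q) * Real.log 2 := by
      have : 21 * (1 + g + Q) * 0.69 ≤ 21 * (1 + g + Q) * Real.log 2 :=
        mul_le_mul_of_nonneg_left (by linarith) (by positivity)
      linarith
    have e3 := mul_le_mul_of_nonneg_right e2 (show 0 ≤ s by linarith)
    nlinarith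
  · have := mul_le_mul_of_nonneg_right (mul_rpow_div_le_Gamma_ratio hp)
      (show 0 ≤ 1 + γ / Real.pi + Q by positivity)
    rw [hA]
    linarith

/-- Jensen is centred at 1, where F is bounded below, while the sums are centred at ±2i; on the
relevant closed half-planes the distances are comparable. Growth is needed only for |z - 1| ≥ 2,
because the Jensen circles have radius above 9/2. -/
theorem zeroSumBound_of_growth {F : ℂ → ℂ} (hF : Differentiable ℂ F) {γ Q : ℝ} (hγ : 0 ≤ γ)
    (hQ : 0 ≤ Q) (h1 : F 1 ≠ 0)
    (h : ∀ z, 2 ≤ ‖z - 1‖ → ‖F z‖ ≤ ‖F 1‖ * Real.exp (‖z - 1‖ * (1 + 2 * γ) + Q)) :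
    ZeroSumBound F 32 γ Q := by
  -- ε = ±1 treats both half-planes at once. The sharp ratio is √5/2, attained at z = -4, and 9/8
  -- lies just above it.
  have key : ∀ z : ℂ, ∀ ε : ℝ, ε ^ 2 = 1 → ε * z.im ≤ 0 →
      2 ≤ ‖z - ε * (2 * Complex.I)‖ ∧ ‖z - 1‖ ≤ 9 / 8 * ‖z - ε * (2 * Complex.I)‖ := by
    intro z ε hε hz
    have e1 : ‖z - ε * (2 * Complex.I)‖ ^ 2 = z.re ^ 2 + (z.im - 2 * ε) ^ 2 := by
      rw [← Complex.normSq_eq_norm_sq, Complex.normSq_apply]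
      simp
      ring
    have e2 : ‖z - 1‖ ^ 2 = (z.re - 1) ^ 2 + z.im ^ 2 := by
      rw [← Complex.normSq_eq_norm_sq, Complex.normSq_apply]
      simp
      ring
    refine ⟨abs_le_of_sq_le_sq' ?_ (norm_nonneg _) |>.2,
      abs_le_of_sq_le_sq' ?_ (by positivity) |>.2⟩
    · rw [e1]
      nlinarith [sq_nonneg z.re, sq_nonneg z.im]
    · rw [mul_pow, e1, e2]
      nlinarith [sq_nonneg (z.re + 4), sq_nonneg z.re, sq_nonneg z.im]
  refine ⟨hF, fun p hp => ⟨?_, ?_⟩⟩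
  · refine tsum_zeros_le hF hγ hQ h1 h _ (2 * Complex.I) (fun z hz => ?_) (fun z hz => ?_) hp
    · simpa using (key z 1 (by norm_num) (by linarith [hz.2])).1
    · simpa using (key z 1 (by norm_num) (by linarith [hz.2])).2
  · have := tsum_zeros_le hF hγ hQ h1 h {k | F k = 0 ∧ 0 ≤ k.im} (-(2 * Complex.I))
      (fun z hz => ?_) (fun z hz => ?_) hp
    · simp only [sub_neg_eq_add] at this
      exact this
    · simpa using (key z (-1) (by norm_num) (by linarith [hz.2])).1
    · simpa using (key z (-1) (by norm_num) (by linarith [hz.2])).2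

/-! ### The three Jost functions -/

theorem ae_eq_zero_of_essSupport_subset {q : ℝ → ℝ} {S : Set ℝ} (h : essSupport q ⊆ S) :
    ∀ᵐ t, t ∉ S → q t = 0 := by
  filter_upwards [ae_eq_zero_of_notMem_essSupport q] with t ht hS using ht fun hm => hS (h hm)

/-- Distance at least 2 from 1 forces |k| ≥ 1, so ‖q‖/|k| ≤ ‖q‖; and |Im k| ≤ |k - 1| because 1 is
real. -/
theorem IsJostPlus.norm_le_of_le {q : ℝ → ℝ} {k : ℂ} {f : ℝ → ℂ} {γ : ℝ} (hf : IsJostPlus q k f)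
    (hq : Integrable q) (hγ0 : 0 ≤ γ) (hγ : ∀ᵐ t, γ < t → q t = 0) (hk : 2 ≤ ‖k - 1‖) :
    (‖deriv f 0 + Complex.I * k * f 0‖ + ‖deriv f 0 - Complex.I * k * f 0‖) / 2 ≤
      ‖k‖ * Real.exp (2 * ‖k - 1‖ * γ + ∫ t, |q t|) := by
  have h1 : 1 ≤ ‖k‖ := by
    have := norm_sub_le k 1
    rw [norm_one] at this
    linarith
  have hk0 : k ≠ 0 := norm_pos_iff.1 (by linarith)
  have hN : 0 ≤ ∫ t, |q t| := integral_nonneg fun t => abs_nonneg _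
  refine (hf.norm_le hq hγ0 hγ hk0).trans (mul_le_mul_of_nonneg_left (Real.exp_le_exp.2 ?_)
    (norm_nonneg _))
  have him : |k.im| ≤ ‖k - 1‖ := by
    simpa using Complex.abs_im_le_norm (k - 1)
  have h2 : (∫ t, |q t|) / ‖k‖ ≤ ∫ t, |q t| := div_le_self hN h1
  have h3 := mul_le_mul_of_nonneg_right him hγ0
  linarith

theorem norm_le_exp_norm_sub_one (k : ℂ) : ‖k‖ ≤ Real.exp ‖k - 1‖ := by
  have h1 : ‖k‖ ≤ ‖k - 1‖ + 1 := by
    calc ‖k‖ = ‖(k - 1) + 1‖ := by ring_nf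
      _ ≤ _ := by simpa using norm_add_le (k - 1) 1
  exact h1.trans (Real.add_one_le_exp _)

/-- At `k = 1` both components of the Jost solution at the origin are bounded above and below. -/
theorem IsJostPlus.norm_bounds_one {q : ℝ → ℝ} {f : ℝ → ℂ} {γ : ℝ}
    (hf : IsJostPlus q 1 f) (hq : Integrable q) (hγ0 : 0 ≤ γ) (hγ : ∀ᵐ t, γ < t → q t = 0) :
    2 ≤ ‖deriv f 0 + Complex.I * f 0‖ ∧ Real.exp (-∫ t, |q t|) ≤ ‖f 0‖ ∧
      Real.exp (-∫ t, |q t|) ≤ ‖deriv f 0‖ := by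
  have hb := hf.norm_le hq hγ0 hγ one_ne_zero
  simp only [mul_one, norm_one, Complex.one_im, abs_zero, mul_zero, zero_mul, zero_add, div_one,
    one_mul] at hb
  have hw : (deriv f 0 * starRingEnd ℂ (f 0)).im = 1 :=
    IsJostPlus.im_deriv_mul_conj (k := 1) (by simpa using hf) hq 0
  set P := deriv f 0 + Complex.I * f 0 with hP
  set N := ∫ t, |q t|
  -- The unit Wronskian bounds the product below, so an upper bound e^N for either factor is a lower
  -- bound e^{-N} for the other.
  have hprod : 1 ≤ ‖deriv f 0‖ * ‖f 0‖ := by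
    have := Complex.abs_im_le_norm (deriv f 0 * starRingEnd ℂ (f 0))
    rw [hw, norm_mul, RCLike.norm_conj, abs_one] at this
    exact this
  have hf0 : ‖f 0‖ ≤ Real.exp N := by
    have h1 := norm_sub_le P (deriv f 0 - Complex.I * f 0)
    rw [hP, show deriv f 0 + Complex.I * f 0 - (deriv f 0 - Complex.I * f 0) =
      2 * (Complex.I * f 0) by ring] at h1
    simp only [norm_mul, Complex.norm_ofNat, Complex.norm_I, one_mul] at h1
    linarith
  have hf1 : ‖deriv f 0‖ ≤ Real.exp N := by
    have h1 := norm_add_le P (deriv f 0 - Complex.I * f 0)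
    rw [hP, show deriv f 0 + Complex.I * f 0 + (deriv f 0 - Complex.I * f 0) =
      2 * deriv f 0 by ring] at h1
    simp only [norm_mul, Complex.norm_ofNat] at h1
    linarith
  have hexp : Real.exp (-N) * Real.exp N = 1 := by rw [← Real.exp_add]; simp
  have hpos := Real.exp_pos N
  refine ⟨?_, ?_, ?_⟩
  -- Polarization: |f' + if|² - |f' - if|² = 4 Im(f' conj f) = 4.
  · have h1 : ‖P‖ ^ 2 = ‖deriv f 0 - Complex.I * f 0‖ ^ 2 + 4 := by
      simp only [Complex.mul_im, Complex.conj_re, Complex.conj_im] at hw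
      rw [hP, ← Complex.normSq_eq_norm_sq, ← Complex.normSq_eq_norm_sq, Complex.normSq_apply,
        Complex.normSq_apply]
      simp only [Complex.add_re, Complex.add_im, Complex.sub_re, Complex.sub_im, Complex.mul_re,
        Complex.mul_im, Complex.I_re, Complex.I_im]
      linear_combination 4 * hw
    nlinarith [sq_nonneg ‖deriv f 0 - Complex.I * f 0‖, norm_nonneg P]
  · refine le_of_mul_le_mul_right ?_ hpos
    rw [hexp]
    nlinarith [norm_nonneg (f 0)]
  · refine le_of_mul_le_mul_right ?_ hpos
    rw [hexp]
    nlinarith [norm_nonneg (deriv f 0)]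

/-- The factor 2 in the upper bound cancels against |w(1)| ≥ 2, so a single ‖q‖ suffices; the factor
|k| is absorbed into e^{|k-1|}. -/
theorem zeroSumBound_jostWronskian {q : ℝ → ℝ} {γ Q : ℝ} (hq : Integrable q) (hγ0 : 0 ≤ γ)
    (h0 : ∀ᵐ t, t < 0 → q t = 0) (hγ : ∀ᵐ t, γ < t → q t = 0)
    (hR : ∀ᵐ t, γ < |t| → q t = 0) (hQ : ∫ t, |q t| ≤ Q) :
    ZeroSumBound (jostWronskian q) 32 γ Q := by
  have hN : 0 ≤ ∫ t, |q t| := integral_nonneg fun t => abs_nonneg _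
  have hj := isJostPlus_jostPlus hq hγ0 hR
  have hw := jostWronskian_eq hq hγ0 hR h0
  have hlow : 2 ≤ ‖jostWronskian q 1‖ := by
    rw [hw, mul_one]
    exact ((hj 1).norm_bounds_one hq hγ0 hγ).1
  refine zeroSumBound_of_growth ?_ hγ0 (hN.trans hQ) (norm_pos_iff.1 (by linarith))
    fun k hk => ?_
  · obtain ⟨d1, d2⟩ := differentiable_jostPlus hq hγ0 hR 0
    rw [funext hw]
    exact d2.add ((differentiable_id.const_mul Complex.I).mul d1)
  · have h1 := (hj k).norm_le_of_le hq hγ0 hγ hk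
    have h2 := norm_nonneg (deriv (jostPlus q k) 0 - Complex.I * k * jostPlus q k 0)
    calc ‖jostWronskian q k‖ ≤ 2 * (‖k‖ * Real.exp (2 * ‖k - 1‖ * γ + ∫ t, |q t|)) := by
          rw [hw]; linarith
      _ ≤ 2 * (Real.exp ‖k - 1‖ * Real.exp (2 * ‖k - 1‖ * γ + Q)) := by
          gcongr
          exact norm_le_exp_norm_sub_one k
      _ = 2 * Real.exp (‖k - 1‖ * (1 + 2 * γ) + Q) := by
          rw [← Real.exp_add]; ring_nf
      _ ≤ _ := mul_le_mul_of_nonneg_right hlow (Real.exp_pos _).le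

/-- One ‖q‖ comes from the growth and one from the lower bound at 1. Recovering ψ₊ from the two
factors divides by |k|, which cancels the factor |k| in the growth bound. -/
theorem zeroSumBound_jostDirichlet {q : ℝ → ℝ} {γ Q : ℝ} (hq : Integrable q) (hγ0 : 0 ≤ γ)
    (hγ : ∀ᵐ t, γ < t → q t = 0) (hR : ∀ᵐ t, γ < |t| → q t = 0) (hQ : 2 * ∫ t, |q t| ≤ Q) :
    ZeroSumBound (jostDirichlet q) 32 γ Q := by
  have hN : 0 ≤ ∫ t, |q t| := integral_nonneg fun t => abs_nonneg _
  have hj := isJostPlus_jostPlus hq hγ0 hR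
  have hlow : Real.exp (-∫ t, |q t|) ≤ ‖jostDirichlet q 1‖ :=
    ((hj 1).norm_bounds_one hq hγ0 hγ).2.1
  refine zeroSumBound_of_growth (differentiable_jostPlus hq hγ0 hR 0).1 hγ0 (by linarith)
    (norm_pos_iff.1 ((Real.exp_pos _).trans_le hlow)) fun k hk => ?_
  have h1 := (hj k).norm_le_of_le hq hγ0 hγ hk
  have hk0 : 0 < ‖k‖ := by
    have := norm_sub_le k 1
    rw [norm_one] at this
    linarith
  have h2 := norm_sub_le (deriv (jostPlus q k) 0 + Complex.I * k * jostPlus q k 0)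
    (deriv (jostPlus q k) 0 - Complex.I * k * jostPlus q k 0)
  rw [show deriv (jostPlus q k) 0 + Complex.I * k * jostPlus q k 0 -
    (deriv (jostPlus q k) 0 - Complex.I * k * jostPlus q k 0) =
      2 * (Complex.I * k * jostPlus q k 0) by ring] at h2
  simp only [norm_mul, Complex.norm_ofNat, Complex.norm_I, one_mul] at h2
  have h3 : ‖jostDirichlet q k‖ ≤ Real.exp (2 * ‖k - 1‖ * γ + ∫ t, |q t|) :=
    le_of_mul_le_mul_left (by rw [jostDirichlet]; linarith) hk0
  calc ‖jostDirichlet q k‖ ≤ Real.exp (2 * ‖k - 1‖ * γ + ∫ t, |q t|) := h3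
    _ ≤ Real.exp (-(∫ t, |q t|) + (‖k - 1‖ * (1 + 2 * γ) + Q)) :=
        Real.exp_le_exp.2 (by linarith)
    _ = Real.exp (-∫ t, |q t|) * Real.exp (‖k - 1‖ * (1 + 2 * γ) + Q) := Real.exp_add _ _
    _ ≤ _ := mul_le_mul_of_nonneg_right hlow (Real.exp_pos _).le

/-- As in the Dirichlet case, but ψ₊' is half the sum of the two factors, so |k| remains and is
absorbed into e^{|k-1|}. -/
theorem zeroSumBound_jostNeumann {q : ℝ → ℝ} {γ Q : ℝ} (hq : Integrable q) (hγ0 : 0 ≤ γ)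
    (hγ : ∀ᵐ t, γ < t → q t = 0) (hR : ∀ᵐ t, γ < |t| → q t = 0) (hQ : 2 * ∫ t, |q t| ≤ Q) :
    ZeroSumBound (jostNeumann q) 32 γ Q := by
  have hN : 0 ≤ ∫ t, |q t| := integral_nonneg fun t => abs_nonneg _
  have hj := isJostPlus_jostPlus hq hγ0 hR
  have hlow : Real.exp (-∫ t, |q t|) ≤ ‖jostNeumann q 1‖ :=
    ((hj 1).norm_bounds_one hq hγ0 hγ).2.2
  refine zeroSumBound_of_growth (differentiable_jostPlus hq hγ0 hR 0).2 hγ0 (by linarith)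
    (norm_pos_iff.1 ((Real.exp_pos _).trans_le hlow)) fun k hk => ?_
  have h1 := (hj k).norm_le_of_le hq hγ0 hγ hk
  have h2 := norm_add_le (deriv (jostPlus q k) 0 + Complex.I * k * jostPlus q k 0)
    (deriv (jostPlus q k) 0 - Complex.I * k * jostPlus q k 0)
  rw [show deriv (jostPlus q k) 0 + Complex.I * k * jostPlus q k 0 +
    (deriv (jostPlus q k) 0 - Complex.I * k * jostPlus q k 0) =
      2 * deriv (jostPlus q k) 0 by ring, norm_mul, Complex.norm_ofNat] at h2
  calc ‖jostNeumann q k‖ ≤ ‖k‖ * Real.exp (2 * ‖k - 1‖ * γ + ∫ t, |q t|) := by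
        rw [jostNeumann]; linarith
    _ ≤ Real.exp ‖k - 1‖ * Real.exp (2 * ‖k - 1‖ * γ + ∫ t, |q t|) :=
        mul_le_mul_of_nonneg_right (norm_le_exp_norm_sub_one k) (Real.exp_pos _).le
    _ ≤ Real.exp (-(∫ t, |q t|) + (‖k - 1‖ * (1 + 2 * γ) + Q)) := by
        rw [← Real.exp_add]
        exact Real.exp_le_exp.2 (by linarith)
    _ = Real.exp (-∫ t, |q t|) * Real.exp (‖k - 1‖ * (1 + 2 * γ) + Q) := Real.exp_add _ _
    _ ≤ _ := mul_le_mul_of_nonneg_right hlow (Real.exp_pos _).le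

theorem theorem1p2 :
    ∃ C : ℝ, 0 < C ∧ C ≤ 2 ^ 5 ∧
      -- Case 1: the line
      (∀ (q : ℝ → ℝ) (γ : ℝ), Integrable q → HasSupportInterval q γ →
        (∀ k : ℂ, (∃! f, IsJostPlus q k f) ∧ (∃! f, IsJostMinus q k f)) ∧
        ZeroSumBound (jostWronskian q) C γ (max (∫ t, |q t|) (∫ t, |t * q t|))) ∧
      -- Cases 2 and 3: the half-line, `q` being extended by zero to the negative axis
      (∀ (q : ℝ → ℝ) (γ : ℝ), Integrable q → IsCompact (essSupport q) →
        essSupport q ⊆ Set.Ici 0 → γ = sSup (essSupport q) →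
        (∀ k : ℂ, ∃! f, IsJostPlus q k f) ∧
        ZeroSumBound (jostDirichlet q) C γ (2 * (∫ t, |q t|) * max 1 γ) ∧
        ZeroSumBound (jostNeumann q) C γ (2 * (∫ t, |q t|) * max 1 γ)) := by
  have outside : ∀ {q : ℝ → ℝ} {γ : ℝ}, 0 ≤ γ → essSupport q ⊆ Set.Icc 0 γ →
      (∀ᵐ t, t < 0 → q t = 0) ∧ (∀ᵐ t, γ < t → q t = 0) ∧ ∀ᵐ t, γ < |t| → q t = 0 := by
    intro q γ hγ hs
    have h := ae_eq_zero_of_essSupport_subset hs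
    refine ⟨?_, ?_, ?_⟩
    · filter_upwards [h] with t ht h0 using ht fun hm => h0.not_ge hm.1
    · filter_upwards [h] with t ht h0 using ht fun hm => h0.not_ge hm.2
    · filter_upwards [h] with t ht h0
      exact ht fun hm => h0.not_ge (by rw [abs_of_nonneg hm.1]; exact hm.2)
  refine ⟨32, by norm_num, by norm_num, fun q γ hq hs => ?_, fun q γ hq hc hpos hγ => ?_⟩
  · obtain ⟨hγ0, hsub, -⟩ := hs
    obtain ⟨h0, h1, h2⟩ := outside hγ0 hsub
    exact ⟨fun k => ⟨existsUnique_isJostPlus hq hγ0 h2 k, existsUnique_isJostMinus hq hγ0 h2 k⟩,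
      zeroSumBound_jostWronskian hq hγ0 h0 h1 h2 (le_max_left _ _)⟩
  · have hγ0 : 0 ≤ γ := by
      rw [hγ]
      exact Real.sSup_nonneg fun x hx => hpos hx
    have hsub : essSupport q ⊆ Set.Icc 0 γ := fun x hx =>
      ⟨hpos hx, by rw [hγ]; exact le_csSup hc.bddAbove hx⟩
    obtain ⟨-, h1, h2⟩ := outside hγ0 hsub
    have hN : 0 ≤ ∫ t, |q t| := integral_nonneg fun t => abs_nonneg _
    have hQ : 2 * ∫ t, |q t| ≤ 2 * (∫ t, |q t|) * max 1 γ :=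
      le_mul_of_one_le_right (by positivity) (le_max_left _ _)
    exact ⟨existsUnique_isJostPlus hq hγ0 h2, zeroSumBound_jostDirichlet hq hγ0 h1 h2 hQ,
      zeroSumBound_jostNeumann hq hγ0 h1 h2 hQ⟩
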